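/- For an integer $s\ge 2$ put $\varphi(s)=\frac{2s}{(s-1)(s+2)}$, and let $p_2(n)=\frac{\log n}{n}$ and $p_s(n)=n^{-\varphi(s)}$ for $s\ge 3$. A $K_r$-factor in a graph is a collection of pairwise vertex-disjoint copies of $K_r$ covering all vertices, and $G_{n,p}$ is the binomial random graph. Theorem 1.3. Let $1<s<r$ be integers. There are $L=L(s)>0$ and $n_0=n_0(r,s)$ such that for every $\varepsilon>0$ there is a constant $c=c(r,s,\varepsilon)>0$ with the following property. For every positive integer $n$ divisible by $r$ there is an $n$-vertex graph $G$ with minimum degree $\delta(G)=\left(1-\frac{s}{r}\right)n$ such that, for $p=c\,p_s(n)$ (which lies in $[0,1]$), the random graph $G\cup G_{n,p}$, with $G_{n,p}$ on the vertex set of $G$, has a $K_r$-factor with probability less than $\varepsilon$. Moreover, $G$ can be taken of the following form. (i) If $s=2$, then $G$ is the complete multipartite graph with $\lfloor r/2\rfloor$ vertex classes of size $\frac{2n}{r}$ and, if $r$ is odd, one further class of size $\frac{n}{r}$. (ii) If $s\ge 3$ and $n\ge n_0$, put $k=n^{1-\varphi(s)}$. Then there is a set $A\subseteq V(G)$ of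 size $N=\frac{sn}{r}+\lceil k\rceil$ such that any two distinct vertices that do not both lie in $A$ are adjacent in $G$, and the induced subgraph $H=G[A]$ is a pseudorandom bipartite graph in the following sense: $H$ is bipartite, $\delta(H)\ge k$, and for every graph $F$ with at most $s+1$ vertices, the number of injective maps $V(F)\to V(H)$ that preserve both adjacency and non-adjacency is at most $L\,N^{v(F)}\left(\frac{k}{N}\right)^{e(F)}$, where $v(F)$ and $e(F)$ are the numbers of vertices and edges of $F$. -/

import Mathlib

namespace PerturbedCliqueFactor

/-- The exponent `φ(s) = 2s / ((s - 1)(s + 2))`, as a real number. -/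
noncomputable def phi (s : ℕ) : ℝ :=
  2 * (s : ℝ) / (((s : ℝ) - 1) * ((s : ℝ) + 2))

/-- The function `p_s(n)`: it is `log n / n` for `s = 2` and `n ^ (-φ(s))` for `s ≥ 3`. -/
noncomputable def pThreshold (s n : ℕ) : ℝ :=
  if s = 2 then Real.log n / n else (n : ℝ) ^ (-phi s)

/-- `G` has a `K_r`-factor: a collection of pairwise vertex-disjoint `r`-cliques of `G`
which together cover all the vertices. -/
def HasCliqueFactor {V : Type*} (r : ℕ) (G : SimpleGraph V) : Prop :=
  ∃ F : Set (Finset V),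
    (∀ K ∈ F, G.IsNClique r K) ∧
    (∀ K ∈ F, ∀ K' ∈ F, K ≠ K' → Disjoint K K') ∧
    ∀ v : V, ∃ K ∈ F, v ∈ K

/-- The sizes of the vertex classes of the complete `⌈r/2⌉`-partite graph on `n` vertices
(`r ∣ n`) with `⌊r/2⌋` classes of size `2n/r` and, if `r` is odd, one further class of
size `n/r`. -/
def classSize (r n : ℕ) (i : Fin ((r + 1) / 2)) : ℕ :=
  if (i : ℕ) < r / 2 then 2 * (n / r) else n / r

/-- A bipartite graph `H` on a finite vertex set, with `N` vertices, minimum degree at least `k`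
and (up to the factor `L`) no more embeddings of any graph `F` on at most `ℓ` vertices than
a random graph of density `k / N` would have:
`|Emb(F, H)| ≤ L * N ^ v(F) * (k / N) ^ e(F)`.
Here `F ↪g H` is the type of injective maps which preserve adjacency in both directions. -/
structure IsPseudorandomBipartite {W : Type*} (H : SimpleGraph W) (ℓ : ℕ) (L k : ℝ) : Prop where
  bipartite : H.IsBipartite
  le_degree : ∀ v : W, k ≤ ((H.neighborSet v).ncard : ℝ)
  card_embedding_le : ∀ m : ℕ, m ≤ ℓ → ∀ F : SimpleGraph (Fin m),
    (Nat.card (F ↪g H) : ℝ) ≤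
      L * (Nat.card W : ℝ) ^ m * (k / (Nat.card W : ℝ)) ^ F.edgeSet.ncard

end PerturbedCliqueFactor

/-! ### Counting the cliques of a factor by their intersection with a set. -/

namespace PerturbedCliqueFactor

open Finset

/-! Let `n = r * m`. A factor has `m` cliques, so if `|A| = s * m + t`, they meet `A` in `s + t/m`
vertices on average. Cliques meeting `A` in fewer than `s` vertices, and the surplus `t`, must be
paid for by cliques meeting `A` in more than `s`; each of these yields its own `(s+1)`-clique inside
`A` (`HasCliqueFactor.add_card_isolated_le`). It remains to make such cliques rare.

For `s = 2`, `A` is a class of size `2m` and `t = 0`. At `p = c log n / n` with `c ≤ 1/8`, `A`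
contains of order at least `n^(3/4)` isolated vertices (second moment), each forcing a deficient
clique, against at most `(log n)^3` expected triangles.

For `s ≥ 3`, `t = ⌈k⌉` and `H = G[A]` is a sparse bipartite graph restoring the minimum degree.
Summing over the pattern `F` that `H` induces on `s + 1` vertices, pseudorandomness bounds the
expected number of `(s+1)`-cliques by `O(c * k)`, since `φ` solves `n^(s+1) * p_s^((s+1).choose 2) =
k` and a bipartite `F` always leaves some edge to the random graph. Markov's inequality finishes
(`binomialRandom_real_hasCliqueFactor_le_of_pseudorandom`). A suitable `H` comes from averaging over
random neighbour choices (`exists_isBipartite_card_embedding_le`).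

For bounded `n`, the graph alone has no factor, and for small `c` the random graph is likely to be
empty. -/

/-- The `k`-cliques of `G` all of whose vertices lie in `A`. -/
noncomputable def cliquesIn {V : Type*} (G : SimpleGraph V) (A : Finset V) (k : ℕ) :
    Finset (Finset V) :=
  open Classical in (A.powersetCard k).filter fun T => G.IsClique (T : Set V)

theorem HasCliqueFactor.add_card_isolated_le {V : Type*} [Fintype V] {G : SimpleGraph V}
    {r s m t : ℕ} (hG : HasCliqueFactor r G) (hs : 1 < s) (hm : Fintype.card V = r * m)
    (hr : 0 < r) (A I : Finset V) (hA : A.card = s * m + t) (hI : I ⊆ A)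
    (hiso : ∀ v ∈ I, ∀ u ∈ A, ¬ G.Adj v u) :
    t + I.card ≤ r * (cliquesIn G A (s + 1)).card := by
  classical
  obtain ⟨F', hcl, hdisj, hcov⟩ := hG
  set F : Finset (Finset V) := F'.toFinset with hF
  have hmem : ∀ K, K ∈ F ↔ K ∈ F' := fun K => by simp [hF]
  have hpd : (F : Set (Finset V)).PairwiseDisjoint id := by
    intro K hK K' hK' hne
    exact hdisj K ((hmem K).1 hK) K' ((hmem K').1 hK') hne
  have hunion : F.biUnion id = univ := by
    ext v
    obtain ⟨K, hK, hv⟩ := hcov v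
    simp only [mem_biUnion, id, mem_univ, iff_true]
    exact ⟨K, (hmem K).2 hK, hv⟩
  have hcardF : F.card = m := by
    have h1 := Finset.card_biUnion hpd
    rw [hunion, card_univ, hm] at h1
    have h2 : ∑ u ∈ F, (id u).card = F.card * r :=
      Finset.sum_const_nat fun K hK => (hcl K ((hmem K).1 hK)).card_eq
    rw [h2, mul_comm] at h1
    exact (Nat.eq_of_mul_eq_mul_right hr h1).symm
  have hcardA : ∑ K ∈ F, (K ∩ A).card = s * m + t := by
    rw [← hA, ← Finset.card_biUnion]
    · congr 1
      ext v
      obtain ⟨K, hK, hv⟩ := hcov v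
      simp only [mem_biUnion, mem_inter]
      exact ⟨fun ⟨_, _, h⟩ => h.2, fun h => ⟨K, (hmem K).2 hK, hv, h⟩⟩
    · intro K hK K' hK' hne
      exact (hpd hK hK' hne).mono inter_subset_left inter_subset_left
  have hle : ∀ K ∈ F, (K ∩ A).card ≤ r := fun K hK =>
    (card_le_card inter_subset_left).trans (hcl K ((hmem K).1 hK)).card_eq.le
  have hsum : t + (F.filter fun K => (K ∩ A).card < s).card
      ≤ r * (F.filter fun K => s + 1 ≤ (K ∩ A).card).card := by
    -- A clique's deficit below `s` is at least 1 when positive, and its excess over `s` is at most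
    -- `r`.
    have h1 : ∑ K ∈ F, ((K ∩ A).card + if (K ∩ A).card < s then 1 else 0)
        ≤ ∑ K ∈ F, (s + r * if s + 1 ≤ (K ∩ A).card then 1 else 0) := by
      refine Finset.sum_le_sum fun K hK => ?_
      have := hle K hK
      split_ifs <;> omega
    rw [sum_add_distrib, sum_add_distrib, hcardA, ← mul_sum, sum_const, hcardF,
      ← card_filter, ← card_filter, smul_eq_mul, mul_comm m s] at h1
    omega
  choose K hKF hvK using hcov
  -- The clique covering an isolated `v ∈ I` meets `A` only in `v`, so it is deficient because `1 <
  -- s`, and different `v` lie in different cliques.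
  have h1 : I.card ≤ (F.filter fun K => (K ∩ A).card < s).card := by
    refine Finset.card_le_card_of_injOn K ?_ ?_
    · intro v hv
      simp only [coe_filter, Set.mem_ofPred_eq]
      refine ⟨(hmem _).2 (hKF v), lt_of_le_of_lt ?_ hs⟩
      refine Finset.card_le_one.2 ?_
      have key : ∀ a ∈ K v ∩ A, a = v := by
        intro a ha
        by_contra hne
        exact hiso v hv a (mem_inter.1 ha).2
          ((hcl _ (hKF v)).isClique (hvK v) (mem_inter.1 ha).1 (Ne.symm hne))
      intro a ha b hb
      rw [key a ha, key b hb]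
    · intro v hv w hw hvw
      by_contra hne
      have hw' : w ∈ K v := hvw ▸ hvK w
      exact hiso v hv w (hI hw) ((hcl _ (hKF v)).isClique (hvK v) hw' hne)
  have h2 : (F.filter fun K => s + 1 ≤ (K ∩ A).card).card ≤ (cliquesIn G A (s + 1)).card := by
    have hex : ∀ K : Finset V, ∃ T : Finset V, s + 1 ≤ (K ∩ A).card →
        T ⊆ K ∩ A ∧ T.card = s + 1 := by
      intro K
      by_cases h : s + 1 ≤ (K ∩ A).card
      · obtain ⟨T, hT⟩ := Finset.exists_subset_card_eq h
        exact ⟨T, fun _ => hT⟩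
      · exact ⟨∅, fun h' => absurd h' h⟩
    choose T hT using hex
    refine Finset.card_le_card_of_injOn T ?_ ?_
    · intro K hK
      simp only [coe_filter, Set.mem_ofPred_eq] at hK
      obtain ⟨hsub, hcard⟩ := hT K hK.2
      simp only [cliquesIn, coe_filter, Set.mem_ofPred_eq, mem_powersetCard]
      refine ⟨⟨hsub.trans inter_subset_right, hcard⟩, ?_⟩
      exact (hcl K ((hmem K).1 hK.1)).isClique.subset
        (by exact_mod_cast hsub.trans inter_subset_left)
    · intro K hK K' hK' heq
      simp only [coe_filter, Set.mem_ofPred_eq] at hK hK'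
      by_contra hne
      obtain ⟨hsub, hcard⟩ := hT K hK.2
      obtain ⟨hsub', -⟩ := hT K' hK'.2
      obtain ⟨x, hx⟩ : (T K).Nonempty := card_pos.1 (by omega)
      exact Finset.disjoint_left.1 (hpd hK.1 hK'.1 hne) (mem_inter.1 (hsub hx)).1
        (mem_inter.1 (hsub' (heq ▸ hx))).1
  calc t + I.card ≤ _ := Nat.add_le_add_left h1 t
    _ ≤ _ := hsum
    _ ≤ _ := Nat.mul_le_mul_left r h2

end PerturbedCliqueFactor

/-! ### Edge events and first moments in the binomial random graph. -/

namespace PerturbedCliqueFactor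

open Finset MeasureTheory ProbabilityTheory

section RandomGraph

variable {V : Type*} [Fintype V]

theorem measurableSet_simpleGraph (S : Set (SimpleGraph V)) : MeasurableSet S := by
  have h : S = SimpleGraph.edgeSet ⁻¹' (SimpleGraph.edgeSet '' S) :=
    (Set.preimage_image_eq _ SimpleGraph.edgeSet_injective).symm
  rw [h]
  exact SimpleGraph.measurableEmbedding_edgeSet.measurable (Set.toFinite _).measurableSet

instance : MeasurableSingletonClass (SimpleGraph V) := ⟨fun _ => measurableSet_simpleGraph _⟩

variable (p : unitInterval)

/-- The predicate `P` lets one independence computation cover both presence (`P x = x`) and absence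
(`P x = ¬ x`) of edges. -/
theorem binomialRandom_apply_cylinder (S : Finset (Sym2 V)) (P : Prop → Prop) (q : ENNReal)
    (hS : ∀ e ∈ S, ¬ e.IsDiag)
    (hq : (unitInterval.toNNReal p • Measure.dirac True +
      unitInterval.toNNReal (unitInterval.symm p) • Measure.dirac False : Measure Prop)
        {x | P x} = q) :
    SimpleGraph.binomialRandom V p {R | ∀ e ∈ S, P (e ∈ R.edgeSet)} = q ^ S.card := by
  classical
  rw [SimpleGraph.binomialRandom_eq_map, Measure.map_apply SimpleGraph.measurable_fromEdgeSet
    (measurableSet_simpleGraph _), setBernoulli_apply']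
  have h : ((fun p : Sym2 V → Prop => {i | p i}) ⁻¹' (SimpleGraph.fromEdgeSet ⁻¹'
      {R | ∀ e ∈ S, P (e ∈ R.edgeSet)})) = (S : Set (Sym2 V)).pi fun _ => {x | P x} := by
    ext x
    simp only [Set.mem_preimage, Set.mem_ofPred_eq, SimpleGraph.edgeSet_fromEdgeSet, Set.mem_pi,
      Finset.mem_coe, Set.mem_sdiff]
    refine forall₂_congr fun e he => ?_
    have : (x e ∧ e ∉ Sym2.diagSet) = x e := by
      simp [hS e he]
    rw [this]
  rw [h, Measure.infinitePi_pi _ (fun _ _ => .of_discrete), Finset.prod_congr rfl (g := fun _ => q),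
    Finset.prod_const]
  intro e he
  have : (¬ e.IsDiag) = True := by simpa using hS e he
  rw [← hq, ← this]
  rfl

theorem binomialRandom_real_forall_mem (S : Finset (Sym2 V)) (hS : ∀ e ∈ S, ¬ e.IsDiag) :
    (SimpleGraph.binomialRandom V p).real {R | ∀ e ∈ S, e ∈ R.edgeSet} = (p : ℝ) ^ S.card := by
  rw [measureReal_def, binomialRandom_apply_cylinder p S (fun x => x) _ hS rfl]
  simp

theorem binomialRandom_real_forall_notMem (S : Finset (Sym2 V)) (hS : ∀ e ∈ S, ¬ e.IsDiag) :
    (SimpleGraph.binomialRandom V p).real {R | ∀ e ∈ S, e ∉ R.edgeSet}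
      = (1 - (p : ℝ)) ^ S.card := by
  rw [measureReal_def, binomialRandom_apply_cylinder p S (fun x => ¬ x) _ hS rfl]
  simp

/-- The expected number of events that hold. -/
theorem integral_card_filter {ι : Type*} (T : Finset ι) (E : ι → SimpleGraph V → Prop)
    [∀ R, DecidablePred fun i => E i R] :
    ∫ R, ((T.filter fun i => E i R).card : ℝ) ∂(SimpleGraph.binomialRandom V p)
      = ∑ i ∈ T, (SimpleGraph.binomialRandom V p).real {R | E i R} := by
  have h : ∀ R, ((T.filter fun i => E i R).card : ℝ)
      = ∑ i ∈ T, Set.indicator {R | E i R} (1 : SimpleGraph V → ℝ) R := by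
    intro R
    rw [Finset.card_filter]
    push_cast
    refine Finset.sum_congr rfl fun i _ => ?_
    by_cases hE : E i R <;> simp [hE]
  simp_rw [h]
  rw [integral_finsetSum _ fun _ _ => Integrable.of_finite]
  exact Finset.sum_congr rfl fun i _ => integral_indicator_one (measurableSet_simpleGraph _)

/-- A factor can appear only if some random edge does; a union bound over ordered pairs suffices, as
this serves bounded `n` only. -/
theorem binomialRandom_real_hasCliqueFactor_sup_le {G : SimpleGraph V} {r : ℕ}
    (hG : ¬ HasCliqueFactor r G) :
    (SimpleGraph.binomialRandom V p).real {R | HasCliqueFactor r (G ⊔ R)}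
      ≤ (Fintype.card V : ℝ) ^ 2 * p := by
  classical
  have hsub : {R | HasCliqueFactor r (G ⊔ R)} ⊆
      ⋃ x ∈ (univ : Finset (V × V)).filter (fun x => x.1 ≠ x.2), {R | R.Adj x.1 x.2} := by
    intro R hR
    by_contra hn
    refine hG ?_
    have : R = ⊥ := by
      ext u v
      simp only [SimpleGraph.bot_adj, iff_false]
      intro huv
      exact hn (Set.mem_biUnion (x := (u, v)) (by simpa using huv.ne) huv)
    rw [Set.mem_ofPred_eq, this, sup_bot_eq] at hR
    exact hR
  calc _ ≤ (SimpleGraph.binomialRandom V p).real _ :=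
      measureReal_mono hsub (measure_ne_top _ _)
    _ ≤ ∑ x ∈ (univ : Finset (V × V)).filter (fun x => x.1 ≠ x.2),
        (SimpleGraph.binomialRandom V p).real {R | R.Adj x.1 x.2} :=
      measureReal_biUnion_finset_le _ _
    _ = ∑ x ∈ (univ : Finset (V × V)).filter (fun x => x.1 ≠ x.2), (p : ℝ) := by
      refine Finset.sum_congr rfl fun x hx => ?_
      have := binomialRandom_real_forall_mem p {s(x.1, x.2)} (by simpa using hx)
      simpa using this
    _ ≤ _ := by
      rw [sum_const, nsmul_eq_mul]
      refine mul_le_mul_of_nonneg_right ?_ p.2.1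
      calc (_ : ℝ) ≤ (univ : Finset (V × V)).card := by exact_mod_cast card_filter_le _ _
        _ = _ := by simp [sq]

end RandomGraph

end PerturbedCliqueFactor

/-! ### Isolated vertices and triangles in an independent set (`s = 2`). -/

namespace PerturbedCliqueFactor

open Finset MeasureTheory ProbabilityTheory

section IsolatedVertices

variable {V : Type*} [Fintype V] (p : unitInterval) (A : Finset V)

/-- The vertices of `A` without a neighbour of `R` in `A`. -/
noncomputable def isolatedIn (R : SimpleGraph V) : Finset V :=
  open Classical in A.filter fun v => ∀ u ∈ A, ¬ R.Adj v u

theorem integral_card_cliquesIn_three_le {G : SimpleGraph V}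
    (hA : ∀ u ∈ A, ∀ v ∈ A, ¬ G.Adj u v) :
    ∫ R, ((cliquesIn (G ⊔ R) A 3).card : ℝ) ∂(SimpleGraph.binomialRandom V p)
      ≤ (A.card * (p : ℝ)) ^ 3 := by
  classical
  have hcl : ∀ R : SimpleGraph V, cliquesIn (G ⊔ R) A 3
      = (A.powersetCard 3).filter fun T : Finset V => (G ⊔ R).IsClique (T : Set V) := by
    intro R
    ext T
    simp [cliquesIn]
  simp_rw [hcl]
  rw [integral_card_filter p (A.powersetCard 3)
    fun T R => (G ⊔ R).IsClique (T : Set V)]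
  have hT : ∀ T ∈ A.powersetCard 3, (SimpleGraph.binomialRandom V p).real
      {R | (G ⊔ R).IsClique (T : Set V)} ≤ (p : ℝ) ^ 3 := by
    intro T hT
    rw [mem_powersetCard] at hT
    have hdiag : ∀ e ∈ T.offDiag.image Sym2.mk.uncurry, ¬ e.IsDiag := by
      intro e he
      obtain ⟨⟨x, y⟩, hx, rfl⟩ := mem_image.1 he
      simpa using (mem_offDiag.1 hx).2.2
    have h := binomialRandom_real_forall_mem p (T.offDiag.image Sym2.mk.uncurry) hdiag
    have hc : (T.offDiag.image Sym2.mk.uncurry).card = 3 := by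
      have := Sym2.card_image_offDiag T
      rw [hT.2] at this
      exact this
    rw [hc] at h
    rw [← h]
    refine measureReal_mono ?_ (measure_ne_top _ _)
    intro R hR e he
    obtain ⟨⟨x, y⟩, hx, rfl⟩ := mem_image.1 he
    obtain ⟨hx1, hx2, hne⟩ := mem_offDiag.1 hx
    have := hR hx1 hx2 hne
    rw [SimpleGraph.sup_adj] at this
    exact this.resolve_left (hA _ (hT.1 hx1) _ (hT.1 hx2))
  have hp : (0 : ℝ) ≤ p := p.2.1
  calc _ ≤ ∑ T ∈ A.powersetCard 3, (p : ℝ) ^ 3 := Finset.sum_le_sum hT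
    _ = (A.card.choose 3 : ℝ) * (p : ℝ) ^ 3 := by simp
    _ ≤ (A.card : ℝ) ^ 3 * (p : ℝ) ^ 3 := by
      gcongr
      exact_mod_cast Nat.choose_le_pow _ _
    _ = _ := by ring

open Classical in
/-- The pairs that must not be edges for `v` to be isolated in `A`. -/
noncomputable def star (v : V) : Finset (Sym2 V) := (A.erase v).image fun u => s(v, u)

omit [Fintype V] in
theorem card_star {v : V} (hv : v ∈ A) : (star A v).card = A.card - 1 := by
  classical
  rw [star, card_image_of_injective _ fun x y h => Sym2.congr_right.1 h]
  convert card_erase_of_mem hv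

omit [Fintype V] in
theorem not_isDiag_of_mem_star {v : V} {e : Sym2 V} (he : e ∈ star A v) : ¬ e.IsDiag := by
  classical
  obtain ⟨x, hx, rfl⟩ := mem_image.1 he
  simpa [eq_comm] using (mem_erase.1 hx).1

omit [Fintype V] in
theorem forall_star_iff {v : V} (R : SimpleGraph V) :
    (∀ e ∈ star A v, e ∉ R.edgeSet) ↔ ∀ u ∈ A, ¬ R.Adj v u := by
  classical
  simp only [star, mem_image, mem_erase, forall_exists_index, and_imp]
  constructor
  · intro h u hu huv
    exact h _ u huv.ne' hu rfl huv
  · rintro h _ u _ hu rfl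
    exact h u hu

theorem integral_card_isolatedIn :
    ∫ R, ((isolatedIn A R).card : ℝ) ∂(SimpleGraph.binomialRandom V p)
      = A.card * (1 - (p : ℝ)) ^ (A.card - 1) := by
  classical
  simp_rw [isolatedIn]
  rw [integral_card_filter p A fun v R => ∀ u ∈ A, ¬ R.Adj v u, Finset.sum_congr rfl
    (g := fun _ => (1 - (p : ℝ)) ^ (A.card - 1))]
  · simp
  · intro v hv
    rw [← card_star A hv, ← binomialRandom_real_forall_notMem p (star A v)
      fun e => not_isDiag_of_mem_star A]
    simp_rw [forall_star_iff]

/-- For distinct `v` and `w`, the two stars share only the pair `vw`, so `2 * (|A| - 1) - 1` pairs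
must be absent. -/
theorem integral_card_isolatedIn_sq_le (hcard : 2 ≤ A.card) :
    ∫ R, ((isolatedIn A R).card : ℝ) ^ 2 ∂(SimpleGraph.binomialRandom V p)
      ≤ A.card * (1 - (p : ℝ)) ^ (A.card - 1)
        + (A.card : ℝ) ^ 2 * (1 - (p : ℝ)) ^ (2 * A.card - 3) := by
  classical
  have hx0 : 0 ≤ 1 - (p : ℝ) := by linarith [p.2.2]
  have hx1 : 1 - (p : ℝ) ≤ 1 := by linarith [p.2.1]
  have h : ∀ R : SimpleGraph V, ((isolatedIn A R).card : ℝ) ^ 2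
      = (((A ×ˢ A).filter fun x => (∀ u ∈ A, ¬ R.Adj x.1 u) ∧ ∀ u ∈ A, ¬ R.Adj x.2 u).card : ℝ) := by
    intro R
    rw [sq, ← Nat.cast_mul, ← card_product]
    congr 2
    ext x
    simp only [isolatedIn, mem_product, mem_filter]
    tauto
  simp_rw [h]
  rw [integral_card_filter p (A ×ˢ A)
    fun x R => (∀ u ∈ A, ¬ R.Adj x.1 u) ∧ ∀ u ∈ A, ¬ R.Adj x.2 u]
  have hbound : ∀ x ∈ A ×ˢ A, (SimpleGraph.binomialRandom V p).real
      {R | (∀ u ∈ A, ¬ R.Adj x.1 u) ∧ ∀ u ∈ A, ¬ R.Adj x.2 u}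
      ≤ (if x.1 = x.2 then (1 - (p : ℝ)) ^ (A.card - 1) else 0)
        + (1 - (p : ℝ)) ^ (2 * A.card - 3) := by
    rintro ⟨v, w⟩ hx
    obtain ⟨hv, hw⟩ := mem_product.1 hx
    have hdiag : ∀ e ∈ star A v ∪ star A w, ¬ e.IsDiag := fun e he =>
      (mem_union.1 he).elim (not_isDiag_of_mem_star A) (not_isDiag_of_mem_star A)
    have h := binomialRandom_real_forall_notMem p _ hdiag
    simp_rw [mem_union, or_imp, forall_and, forall_star_iff] at h
    simp only at hv hw ⊢
    rw [h]
    split_ifs with hvw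
    · subst hvw
      rw [union_self, card_star A hv]
      exact le_add_of_nonneg_right (pow_nonneg hx0 _)
    · rw [zero_add]
      refine pow_le_pow_of_le_one hx0 hx1 ?_
      have h1 := card_union_add_card_inter (star A v) (star A w)
      have h2 : (star A v ∩ star A w).card ≤ 1 := by
        refine card_le_one.2 ?_
        have key : ∀ e ∈ star A v ∩ star A w, e = s(v, w) := by
          intro e he
          obtain ⟨h1, h2⟩ := mem_inter.1 he
          obtain ⟨x, hx, rfl⟩ := mem_image.1 h1
          obtain ⟨y, hy, hxy⟩ := mem_image.1 h2
          have := Sym2.eq_iff.1 hxy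
          rcases this with h | h
          · exact absurd h.1.symm hvw
          · rw [h.1]
        intro a ha b hb
        rw [key a ha, key b hb]
      rw [card_star A hv, card_star A hw] at h1
      omega
  refine (Finset.sum_le_sum hbound).trans (le_of_eq ?_)
  rw [sum_add_distrib, sum_product]
  simp [sq]

/-- Chebyshev's inequality with deviation `M / 2`, where `M` is the mean; the variance is at most `M
+ M² p / (1 - p)`. -/
theorem binomialRandom_real_card_isolatedIn_le (hcard : 2 ≤ A.card) (hp : (p : ℝ) < 1) :
    (SimpleGraph.binomialRandom V p).real
      {R | ((isolatedIn A R).card : ℝ) ≤ A.card * (1 - (p : ℝ)) ^ (A.card - 1) / 2}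
      ≤ 4 / (A.card * (1 - (p : ℝ)) ^ (A.card - 1)) + 4 * p / (1 - p) := by
  set M : ℝ := A.card * (1 - (p : ℝ)) ^ (A.card - 1) with hM
  have hx : 0 < 1 - (p : ℝ) := by linarith
  have hA : (0 : ℝ) < A.card := by exact_mod_cast (by omega : 0 < A.card)
  have hM0 : 0 < M := by positivity
  have hint : ∫ R, (((isolatedIn A R).card : ℝ) - M) ^ 2 ∂(SimpleGraph.binomialRandom V p)
      ≤ M + M ^ 2 * (p / (1 - p)) := by
    have h1 : ∀ R : SimpleGraph V, (((isolatedIn A R).card : ℝ) - M) ^ 2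
        = ((isolatedIn A R).card : ℝ) ^ 2 - 2 * M * ((isolatedIn A R).card : ℝ) + M ^ 2 :=
      fun R => by ring
    simp_rw [h1]
    rw [integral_add Integrable.of_finite Integrable.of_finite,
      integral_sub Integrable.of_finite Integrable.of_finite, integral_const_mul,
      integral_card_isolatedIn, ← hM]
    have h2 := integral_card_isolatedIn_sq_le p A hcard
    rw [← hM] at h2
    have h3 : (A.card : ℝ) ^ 2 * (1 - (p : ℝ)) ^ (2 * A.card - 3) = M ^ 2 / (1 - p) := by
      rw [eq_div_iff hx.ne', hM, mul_pow, mul_assoc, ← pow_succ, ← pow_mul]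
      congr 2
      omega
    have h4 : M ^ 2 / (1 - (p : ℝ)) = M ^ 2 + M ^ 2 * (p / (1 - p)) := by
      field_simp
      ring
    rw [h3, h4] at h2
    simp only [integral_const, probReal_univ, smul_eq_mul, one_mul]
    nlinarith
  have hmark := mul_meas_ge_le_integral_of_nonneg (μ := SimpleGraph.binomialRandom V p)
    (f := fun R => (((isolatedIn A R).card : ℝ) - M) ^ 2)
    (Filter.Eventually.of_forall fun R => sq_nonneg _) Integrable.of_finite (M ^ 2 / 4)
  have hsub : {R : SimpleGraph V | ((isolatedIn A R).card : ℝ) ≤ M / 2}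
      ⊆ {R | M ^ 2 / 4 ≤ (((isolatedIn A R).card : ℝ) - M) ^ 2} := by
    intro R hR
    simp only [Set.mem_ofPred_eq] at hR ⊢
    nlinarith
  have hle : (SimpleGraph.binomialRandom V p).real _ ≤ _ :=
    measureReal_mono hsub (measure_ne_top _ _)
  have h5 : 4 / M + 4 * (p : ℝ) / (1 - p) = (M + M ^ 2 * (p / (1 - p))) / (M ^ 2 / 4) := by
    field_simp
  rw [h5, le_div_iff₀ (by positivity), mul_comm]
  calc _ ≤ M ^ 2 / 4 * _ := mul_le_mul_of_nonneg_left hle (by positivity)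
    _ ≤ _ := hmark.trans hint

/-- A factor forces the number of isolated vertices to be at most `r` times the number of triangles.
Hence either there are at most `M / 2` isolated vertices (Chebyshev) or at least `M / (2r)`
triangles (Markov). -/
theorem binomialRandom_real_hasCliqueFactor_le_of_independent {G : SimpleGraph V} {r m : ℕ}
    (hA : ∀ u ∈ A, ∀ v ∈ A, ¬ G.Adj u v) (hr : 0 < r) (hm : 0 < m)
    (hV : Fintype.card V = r * m) (hcard : A.card = 2 * m) (hp : (p : ℝ) < 1) :
    (SimpleGraph.binomialRandom V p).real {R | HasCliqueFactor r (G ⊔ R)}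
      ≤ 4 / (A.card * (1 - (p : ℝ)) ^ (A.card - 1)) + 4 * p / (1 - p)
        + 2 * r * (A.card * (p : ℝ)) ^ 3 / (A.card * (1 - (p : ℝ)) ^ (A.card - 1)) := by
  have h1 := binomialRandom_real_card_isolatedIn_le p A (by omega) hp
  set M : ℝ := A.card * (1 - (p : ℝ)) ^ (A.card - 1) with hM
  have hx : 0 < 1 - (p : ℝ) := by linarith
  have hA0 : (0 : ℝ) < A.card := by exact_mod_cast (by omega : 0 < A.card)
  have hr0 : (0 : ℝ) < r := by exact_mod_cast hr
  have hM0 : 0 < M := by positivity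
  have hmark := mul_meas_ge_le_integral_of_nonneg (μ := SimpleGraph.binomialRandom V p)
    (f := fun R => ((cliquesIn (G ⊔ R) A 3).card : ℝ))
    (Filter.Eventually.of_forall fun R => Nat.cast_nonneg _) Integrable.of_finite (M / (2 * r))
  have h2 := hmark.trans (integral_card_cliquesIn_three_le p A hA)
  have hsub : {R | HasCliqueFactor r (G ⊔ R)} ⊆
      {R : SimpleGraph V | ((isolatedIn A R).card : ℝ) ≤ M / 2} ∪
      {R | M / (2 * r) ≤ ((cliquesIn (G ⊔ R) A 3).card : ℝ)} := by
    intro R hR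
    have h := hR.add_card_isolated_le (s := 2) (t := 0) (by norm_num) hV hr A (isolatedIn A R)
      hcard (by classical exact filter_subset _ _) (by
        intro v hv u hu
        classical
        rw [isolatedIn, mem_filter] at hv
        rw [SimpleGraph.sup_adj]
        exact not_or.2 ⟨hA v hv.1 u hu, hv.2 u hu⟩)
    rw [zero_add] at h
    have h' : ((isolatedIn A R).card : ℝ) ≤ r * (cliquesIn (G ⊔ R) A 3).card := by
      exact_mod_cast h
    by_cases hc : ((isolatedIn A R).card : ℝ) ≤ M / 2
    · exact Or.inl hc
    · right
      simp only [Set.mem_ofPred_eq]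
      rw [div_le_iff₀ (by positivity)]
      push Not at hc
      nlinarith
  refine (measureReal_mono hsub (measure_ne_top _ _)).trans ((measureReal_union_le _ _).trans
    (add_le_add h1 ?_))
  rw [le_div_iff₀ hM0]
  have h3 := mul_le_mul_of_nonneg_left h2 (by positivity : (0 : ℝ) ≤ 2 * r)
  rw [← mul_assoc, mul_div_cancel₀ M (by positivity : (2 * r : ℝ) ≠ 0), mul_comm M] at h3
  exact h3

end IsolatedVertices

end PerturbedCliqueFactor

/-! ### Asymptotics of the failure bound for `s = 2`. -/

namespace PerturbedCliqueFactor

open Finset MeasureTheory ProbabilityTheory Filter Topology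

theorem exp_neg_two_mul_le {x : ℝ} (h0 : 0 ≤ x) (h1 : x ≤ 1 / 2) : Real.exp (-(2 * x)) ≤ 1 - x := by
  have h := Real.add_one_le_exp (2 * x)
  rw [Real.exp_neg, inv_le_comm₀ (Real.exp_pos _) (by linarith)]
  refine le_trans ?_ h
  rw [inv_le_iff_one_le_mul₀ (by linarith)]
  nlinarith

theorem tendsto_isolated_bound (r : ℝ) :
    Tendsto (fun n : ℕ => 2 * r * (n : ℝ) ^ (-(3 / 4) : ℝ) + 8 * (Real.log n / n)
      + r ^ 2 * (Real.log n ^ 3 / (n : ℝ) ^ (3 / 4 : ℝ))) atTop (𝓝 0) := by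
  have h1 : Tendsto (fun n : ℕ => (n : ℝ) ^ (-(3 / 4) : ℝ)) atTop (𝓝 0) :=
    (tendsto_rpow_neg_atTop (by norm_num)).comp tendsto_natCast_atTop_atTop
  have h2 : Tendsto (fun n : ℕ => Real.log n / n) atTop (𝓝 0) := by
    have := (isLittleO_log_rpow_atTop (r := 1) (by norm_num)).tendsto_div_nhds_zero
    simp only [Real.rpow_one] at this
    exact this.comp tendsto_natCast_atTop_atTop
  have h3 : Tendsto (fun n : ℕ => Real.log n ^ 3 / (n : ℝ) ^ (3 / 4 : ℝ)) atTop (𝓝 0) := by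
    have := (isLittleO_log_rpow_rpow_atTop (s := 3 / 4) 3 (by norm_num)).tendsto_div_nhds_zero
    have := this.comp tendsto_natCast_atTop_atTop (α := ℕ)
    refine this.congr fun n => ?_
    simp only [Function.comp]
    norm_cast
  have := ((h1.const_mul (2 * r)).add (h2.const_mul 8)).add (h3.const_mul (r ^ 2))
  simpa using this

/-- The threshold `n₁` is uniform in `c ≤ 1/8`, so that `c` can afterwards be chosen small in terms
of `n₁` to handle `n < n₁`. -/
theorem exists_isolated_bound_lt (r : ℕ) (hr : 2 < r) {ε : ℝ} (hε : 0 < ε) :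
    ∃ n₁ : ℕ, ∀ m c : ℝ, ∀ n : ℕ, n₁ ≤ n → (n : ℝ) = r * m → 0 < c → c ≤ 1 / 8 →
      ∀ a : ℕ, (a : ℝ) = 2 * m → ∀ p : ℝ, p = c * (Real.log n / n) →
      4 / (a * (1 - p) ^ (a - 1)) + 4 * p / (1 - p)
        + 2 * r * (a * p) ^ 3 / (a * (1 - p) ^ (a - 1)) < ε := by
  obtain ⟨n₁, hn₁⟩ := Filter.eventually_atTop.1
    ((tendsto_isolated_bound r).eventually_lt_const hε)
  refine ⟨max n₁ 1, ?_⟩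
  intro m c n hn hnm hc0 hc1 a ha p hp
  have hn0 : (1 : ℝ) ≤ n := by exact_mod_cast (le_max_right _ _).trans hn
  have hr0 : (2 : ℝ) < r := by exact_mod_cast hr
  have hm0 : 0 < m := by
    by_contra h
    push Not at h
    nlinarith
  have hlog0 : 0 ≤ Real.log n := Real.log_nonneg hn0
  have hlog1 : Real.log n / n ≤ 1 := by
    rw [div_le_one (by linarith)]
    linarith [Real.log_le_sub_one_of_pos (by linarith : (0 : ℝ) < n)]
  have hq0 : 0 ≤ Real.log n / n := by positivity
  have hp0 : 0 ≤ p := by rw [hp]; positivity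
  have hp1 : p ≤ 1 / 2 := by rw [hp]; nlinarith
  have hpq : p ≤ Real.log n / n := by rw [hp]; nlinarith
  have ha0 : (0 : ℝ) < a := by rw [ha]; linarith
  have han : (a : ℝ) ≤ n := by rw [ha, hnm]; nlinarith
  have han' : a ≤ n := by exact_mod_cast han
  -- Since `1 - p ≥ exp (-2p)` and `n * p = c * log n`, the exponent is `2c ≤ 1/4`.
  have hpow : (n : ℝ) ^ (-(1 / 4) : ℝ) ≤ (1 - p) ^ (a - 1) := by
    calc (n : ℝ) ^ (-(1 / 4) : ℝ) ≤ Real.exp (-(2 * p)) ^ n := by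
          rw [← Real.exp_nat_mul, Real.rpow_def_of_pos (by linarith)]
          refine Real.exp_le_exp.2 ?_
          have : (n : ℝ) * p = c * Real.log n := by
            rw [hp]
            field_simp
          nlinarith
      _ ≤ (1 - p) ^ n := by
          gcongr
          exact exp_neg_two_mul_le hp0 hp1
      _ ≤ (1 - p) ^ (a - 1) :=
          pow_le_pow_of_le_one (by linarith) (by linarith) (by omega)
  have hM : (2 / r) * (n : ℝ) ^ (3 / 4 : ℝ) ≤ a * (1 - p) ^ (a - 1) := by
    have h1 : (a : ℝ) = 2 / r * n := by
      rw [ha, hnm]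
      field_simp
    have h2 : (n : ℝ) ^ (3 / 4 : ℝ) = n * (n : ℝ) ^ (-(1 / 4) : ℝ) := by
      nth_rewrite 2 [← Real.rpow_one (n : ℝ)]
      rw [← Real.rpow_add (by linarith)]
      norm_num
    calc _ = a * (n : ℝ) ^ (-(1 / 4) : ℝ) := by rw [h1, h2]; ring
      _ ≤ _ := by gcongr
  have hx : 0 < (n : ℝ) ^ (3 / 4 : ℝ) := Real.rpow_pos_of_pos (by linarith) _
  set M := (a : ℝ) * (1 - p) ^ (a - 1)
  have hden : 0 < (2 / r) * (n : ℝ) ^ (3 / 4 : ℝ) := by positivity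
  refine lt_of_le_of_lt ?_ (hn₁ n ((le_max_left _ _).trans hn))
  refine add_le_add (add_le_add ?_ ?_) ?_
  · calc 4 / M ≤ 4 / ((2 / r) * (n : ℝ) ^ (3 / 4 : ℝ)) := by gcongr
      _ = 2 * r * (n : ℝ) ^ (-(3 / 4) : ℝ) := by
        rw [Real.rpow_neg (by linarith)]
        field_simp
        norm_num
  · rw [div_le_iff₀ (by linarith)]
    nlinarith
  · have hap : (a : ℝ) * p ≤ Real.log n := by
      calc (a : ℝ) * p ≤ n * (Real.log n / n) := by gcongr
        _ = Real.log n := by field_simp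
    calc 2 * r * (a * p) ^ 3 / M
        ≤ 2 * r * Real.log n ^ 3 / ((2 / r) * (n : ℝ) ^ (3 / 4 : ℝ)) := by gcongr
      _ = _ := by field_simp

end PerturbedCliqueFactor

/-! ### Bipartite graphs from random neighbour choices. -/

namespace PerturbedCliqueFactor

open Finset

/-- Each prescribed value divides the number of functions by `|β|`, unless two prescriptions
conflict and no function is left. The product form avoids division. -/
theorem card_filter_forall_eq_mul_pow_le {α β : Type*} [Fintype α] [Fintype β] [DecidableEq α]
    [DecidableEq β] (E : Finset (α × β)) :
    ((univ : Finset (α → β)).filter fun f => ∀ x ∈ E, f x.1 = x.2).card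
      * Fintype.card β ^ E.card ≤ Fintype.card (α → β) := by
  have h1 : ((univ : Finset (α → β)).filter fun f => ∀ x ∈ E, f x.1 = x.2)
      = Fintype.piFinset fun a => univ.filter fun b => ∀ x ∈ E, x.1 = a → b = x.2 := by
    ext f
    simp only [mem_filter, mem_univ, true_and, Fintype.mem_piFinset]
    exact ⟨fun h a x hx hxa => hxa ▸ h x hx, fun h x hx => h x.1 x hx rfl⟩
  have h2 : E.card = ∑ a : α, (E.filter fun x => x.1 = a).card :=
    Finset.card_eq_sum_card_fiberwise fun x _ => mem_coe.2 (mem_univ x.1)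
  rw [h1, Fintype.card_piFinset, h2, ← prod_pow_eq_pow_sum, ← prod_mul_distrib,
    Fintype.card_fun, ← Finset.card_univ (α := α), ← prod_const]
  refine Finset.prod_le_prod' fun a _ => ?_
  rcases (E.filter fun x => x.1 = a).eq_empty_or_nonempty with h | ⟨x, hx⟩
  · rw [h, card_empty, pow_zero, mul_one]
    exact card_le_univ _
  · obtain ⟨hxE, hxa⟩ := mem_filter.1 hx
    by_cases hex : ∃ y ∈ E, y.1 = a ∧ y.2 ≠ x.2
    · obtain ⟨y, hyE, hya, hyx⟩ := hex
      have : (univ.filter fun b => ∀ x ∈ E, x.1 = a → b = x.2) = ∅ := by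
        refine filter_eq_empty_iff.2 fun b _ hb => hyx ?_
        rw [← hb y hyE hya, ← hb x hxE hxa]
      rw [this, card_empty, zero_mul]
      exact Nat.zero_le _
    · push Not at hex
      have h3 : (E.filter fun x => x.1 = a).card ≤ 1 := by
        refine card_le_one.2 fun y hy z hz => ?_
        obtain ⟨hyE, hya⟩ := mem_filter.1 hy
        obtain ⟨hzE, hza⟩ := mem_filter.1 hz
        exact Prod.ext (hya.trans hza.symm) ((hex y hyE hya).trans (hex z hzE hza).symm)
      have h4 : (univ.filter fun b => ∀ x ∈ E, x.1 = a → b = x.2).card ≤ 1 := by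
        refine card_le_one.2 fun b hb b' hb' => ?_
        rw [(mem_filter.1 hb).2 x hxE hxa, (mem_filter.1 hb').2 x hxE hxa]
      have h5 : 0 < Fintype.card β := Fintype.card_pos_iff.2 ⟨x.2⟩
      calc _ ≤ 1 * Fintype.card β ^ 1 := Nat.mul_le_mul h4 (Nat.pow_le_pow_right h5 h3)
        _ = _ := by simp

section PickGraph

variable {V : Type*} {d q : ℕ}

/-- The bipartite graph in which every vertex `u` picks `d` neighbours on the other side, the
`b`-th one being `ι (!side u, b, f (u, b))`. -/
def pickGraph (side : V → Bool) (ι : Bool × Fin d × Fin q → V) (f : V × Fin d → Fin q) :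
    SimpleGraph V :=
  SimpleGraph.fromRel fun u v => ∃ b, v = ι (!side u, b, f (u, b))

variable {side : V → Bool} {ι : Bool × Fin d × Fin q → V} (hι : Function.Injective ι)
  (hside : ∀ x, side (ι x) = x.1)

include hside in
theorem pickGraph_side_ne {f : V × Fin d → Fin q} {u v : V} (h : (pickGraph side ι f).Adj u v) :
    side u ≠ side v := by
  rw [pickGraph, SimpleGraph.fromRel_adj] at h
  rcases h.2 with ⟨b, hb⟩ | ⟨b, hb⟩
  · rw [hb, hside]
    simp
  · rw [hb, hside]
    simp

include hside in
theorem pickGraph_isBipartite (f : V × Fin d → Fin q) : (pickGraph side ι f).IsBipartite := by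
  have := (SimpleGraph.Coloring.mk side fun h => pickGraph_side_ne hside h :
    (pickGraph side ι f).Coloring Bool).colorable
  simpa [SimpleGraph.IsBipartite] using this

include hι hside in
theorem le_ncard_neighborSet_pickGraph [Finite V] (f : V × Fin d → Fin q) (u : V) :
    d ≤ ((pickGraph side ι f).neighborSet u).ncard := by
  have hinj : Function.Injective fun b : Fin d => ι (!side u, b, f (u, b)) := fun b b' h => by
    have := hι h
    simp only [Prod.mk.injEq] at this
    exact this.2.1
  have hsub : Set.range (fun b : Fin d => ι (!side u, b, f (u, b)))
      ⊆ (pickGraph side ι f).neighborSet u := by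
    rintro _ ⟨b, rfl⟩
    rw [SimpleGraph.mem_neighborSet, pickGraph, SimpleGraph.fromRel_adj]
    refine ⟨fun h => ?_, Or.inl ⟨b, rfl⟩⟩
    have := congrArg side h
    rw [hside] at this
    simp at this
  have h := Set.ncard_le_ncard hsub (Set.toFinite _)
  rwa [Set.ncard_range_of_injective hinj, Nat.card_eq_fintype_card, Fintype.card_fin] at h

open Classical in
/-- The edges of a graph on `Fin m` as increasing pairs. -/
noncomputable def orderedEdges {m : ℕ} (F : SimpleGraph (Fin m)) : Finset (Fin m × Fin m) :=
  univ.filter fun x => x.1 < x.2 ∧ F.Adj x.1 x.2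

theorem mem_orderedEdges {m : ℕ} {F : SimpleGraph (Fin m)} {x : Fin m × Fin m} :
    x ∈ orderedEdges F ↔ x.1 < x.2 ∧ F.Adj x.1 x.2 := by
  simp [orderedEdges]

theorem card_orderedEdges {m : ℕ} (F : SimpleGraph (Fin m)) :
    (orderedEdges F).card = F.edgeSet.ncard := by
  classical
  rw [← Set.ncard_coe_finset]
  refine Set.ncard_congr (fun x _ => s(x.1, x.2)) ?_ ?_ ?_
  · intro x hx
    exact (mem_orderedEdges.1 hx).2
  · rintro ⟨a, b⟩ ⟨c, e⟩ hx hy h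
    have h1 := (mem_orderedEdges.1 hx).1
    have h2 := (mem_orderedEdges.1 hy).1
    rcases Sym2.eq_iff.1 h with h | h
    · exact Prod.ext h.1 h.2
    · simp only at h h1 h2
      rw [h.1, h.2] at h1
      exact absurd h1 h2.asymm
  · intro e
    induction e using Sym2.ind with
    | _ a b =>
      intro h
      rcases lt_or_gt_of_ne (SimpleGraph.Adj.ne h) with hab | hab
      · exact ⟨(a, b), mem_orderedEdges.2 ⟨hab, h⟩, rfl⟩
      · exact ⟨(b, a), mem_orderedEdges.2 ⟨hab, SimpleGraph.Adj.symm h⟩, Sym2.eq_swap⟩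

variable [Fintype V]

include hι in
open Classical in
/-- The number of choices for which all pairs in a given set are picked in a given orientation. -/
theorem card_filter_oriented_mul_pow_le {m : ℕ} (D : Finset (Fin m × Fin m)) (φ : Fin m → V)
    (hφ : Function.Injective φ) :
    ((univ : Finset (V × Fin d → Fin q)).filter fun f =>
        ∀ x ∈ D, ∃ b, φ x.2 = ι (!side (φ x.1), b, f (φ x.1, b))).card * q ^ D.card
      ≤ Fintype.card (V × Fin d → Fin q) := by
  rcases ((univ : Finset (V × Fin d → Fin q)).filter fun f =>
        ∀ x ∈ D, ∃ b, φ x.2 = ι (!side (φ x.1), b, f (φ x.1, b))).eq_empty_or_nonempty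
    with h | ⟨f₀, hf₀⟩
  · rw [h, card_empty, zero_mul]
    exact Nat.zero_le _
  rcases D.eq_empty_or_nonempty with hD | ⟨x₀, hx₀⟩
  · rw [hD, card_empty, pow_zero, mul_one]
    exact card_le_univ _
  obtain ⟨b₀, -⟩ := (mem_filter.1 hf₀).2 x₀ hx₀
  have hq : 0 < q := (f₀ (φ x₀.1, b₀)).pos
  have : Nonempty (Fin d) := ⟨b₀⟩
  -- By injectivity of `ι`, the target `φ x.2` determines both the index `b` and the value `f (φ
  -- x.1, b)`, so an oriented pair prescribes one value of `f`.
  set E : Finset ((V × Fin d) × Fin q) := univ.filter fun y =>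
    ∃ x ∈ D, y.1.1 = φ x.1 ∧ φ x.2 = ι (!side (φ x.1), y.1.2, y.2) with hE
  have hsub : ((univ : Finset (V × Fin d → Fin q)).filter fun f =>
        ∀ x ∈ D, ∃ b, φ x.2 = ι (!side (φ x.1), b, f (φ x.1, b)))
      ⊆ univ.filter fun f => ∀ y ∈ E, f y.1 = y.2 := by
    intro f hf
    simp only [mem_filter, mem_univ, true_and, hE] at hf ⊢
    rintro ⟨⟨u, b⟩, t⟩ ⟨x, hxD, hu, hx⟩
    simp only at hu hx ⊢
    obtain ⟨b', hb'⟩ := hf x hxD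
    have := hι (hx.symm.trans hb')
    simp only [Prod.mk.injEq, true_and] at this
    rw [hu, this.1, this.2]
  -- The fixed solution `f₀` supplies a prescription for every pair of `D`; distinct pairs give
  -- distinct prescriptions.
  have hcard : D.card ≤ E.card := by
    simp only [mem_filter, mem_univ, true_and] at hf₀
    choose! b hb using hf₀
    refine Finset.card_le_card_of_injOn
      (fun x => ((φ x.1, b x), f₀ (φ x.1, b x))) ?_ ?_
    · intro x hx
      simp only [hE, coe_filter, mem_univ, true_and, Set.mem_ofPred_eq]
      exact ⟨x, hx, rfl, hb x hx⟩
    · intro x hx y hy hxy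
      simp only [Prod.mk.injEq] at hxy
      have h1 : x.1 = y.1 := hφ hxy.1.1
      refine Prod.ext h1 (hφ ?_)
      rw [hb x hx, hb y hy, h1, hxy.1.2]
  calc _ ≤ (univ.filter fun f : V × Fin d → Fin q => ∀ y ∈ E, f y.1 = y.2).card * q ^ E.card :=
        Nat.mul_le_mul (card_le_card hsub) (Nat.pow_le_pow_right hq hcard)
    _ ≤ _ := by simpa using card_filter_forall_eq_mul_pow_le E

-- Every edge is picked from one of its endpoints. A union bound over the orientations of `F` costs
-- the factor `2 ^ e(F)`.
include hι in
open Classical in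
theorem card_filter_pickGraph_mul_pow_le {m : ℕ} (F : SimpleGraph (Fin m)) (φ : Fin m → V)
    (hφ : Function.Injective φ) :
    ((univ : Finset (V × Fin d → Fin q)).filter fun f =>
        ∀ i j, F.Adj i j → (pickGraph side ι f).Adj (φ i) (φ j)).card * q ^ F.edgeSet.ncard
      ≤ 2 ^ F.edgeSet.ncard * Fintype.card (V × Fin d → Fin q) := by
  set P := orderedEdges F with hP
  -- The set `O` encodes an orientation: its pairs keep their increasing order, the others are
  -- reversed.
  let w : Finset (Fin m × Fin m) → Fin m × Fin m → Fin m × Fin m :=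
    fun O x => if x ∈ O then x else x.swap
  have hw : ∀ O, Set.InjOn (w O) P := by
    rintro O ⟨a, b⟩ hx ⟨c, e⟩ hy h
    have h1 := (mem_orderedEdges.1 hx).1
    have h2 := (mem_orderedEdges.1 hy).1
    simp only [w] at h h1 h2
    split_ifs at h
    · exact h
    · simp only [Prod.swap, Prod.mk.injEq] at h
      rw [h.1, h.2] at h1
      exact absurd h1 h2.asymm
    · simp only [Prod.swap, Prod.mk.injEq] at h
      rw [h.1, h.2] at h1
      exact absurd h1 h2.asymm
    · exact Prod.swap_injective h
  have hsub : ((univ : Finset (V × Fin d → Fin q)).filter fun f =>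
        ∀ i j, F.Adj i j → (pickGraph side ι f).Adj (φ i) (φ j))
      ⊆ P.powerset.biUnion fun O => univ.filter fun f =>
        ∀ x ∈ P.image (w O), ∃ b, φ x.2 = ι (!side (φ x.1), b, f (φ x.1, b)) := by
    intro f hf
    simp only [mem_filter, mem_univ, true_and] at hf
    refine mem_biUnion.2
      ⟨P.filter fun x => ∃ b, φ x.2 = ι (!side (φ x.1), b, f (φ x.1, b)), ?_, ?_⟩
    · exact mem_powerset.2 (filter_subset _ _)
    · simp only [mem_filter, mem_univ, true_and]
      intro y hy
      obtain ⟨x, hx, rfl⟩ := mem_image.1 hy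
      simp only [w, mem_filter]
      split_ifs with h
      · exact h.2
      · have hadj := hf x.1 x.2 (mem_orderedEdges.1 hx).2
        rw [pickGraph, SimpleGraph.fromRel_adj] at hadj
        exact hadj.2.resolve_left fun h' => h ⟨hx, h'⟩
  rw [← card_orderedEdges F]
  calc _ ≤ (∑ O ∈ P.powerset, (univ.filter fun f : V × Fin d → Fin q =>
        ∀ x ∈ P.image (w O), ∃ b, φ x.2 = ι (!side (φ x.1), b, f (φ x.1, b))).card) * q ^ P.card :=
        Nat.mul_le_mul_right _ ((card_le_card hsub).trans card_biUnion_le)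
    _ = ∑ O ∈ P.powerset, (univ.filter fun f : V × Fin d → Fin q =>
        ∀ x ∈ P.image (w O), ∃ b, φ x.2 = ι (!side (φ x.1), b, f (φ x.1, b))).card
          * q ^ (P.image (w O)).card := by
        rw [sum_mul]
        refine Finset.sum_congr rfl fun O _ => ?_
        rw [card_image_of_injOn (hw O)]
    _ ≤ ∑ O ∈ P.powerset, Fintype.card (V × Fin d → Fin q) :=
        Finset.sum_le_sum fun O _ => card_filter_oriented_mul_pow_le hι _ φ hφ
    _ = _ := by rw [sum_const, card_powerset, smul_eq_mul]

open Classical in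
/-- The injective homomorphisms from a graph on `Fin m`. -/
noncomputable def injHoms {m : ℕ} (F : SimpleGraph (Fin m)) (H : SimpleGraph V) :
    Finset (Fin m → V) :=
  univ.filter fun φ => Function.Injective φ ∧ ∀ i j, F.Adj i j → H.Adj (φ i) (φ j)

/-- Induced copies are not monotone in the host graph, but injective homomorphisms are; this allows
edges to be deleted after the averaging. -/
theorem natCard_embedding_le_card_injHoms {m : ℕ} (F : SimpleGraph (Fin m)) {H H' : SimpleGraph V}
    (h : H ≤ H') : Nat.card (F ↪g H) ≤ (injHoms F H').card := by
  rw [← Fintype.card_coe, ← Nat.card_eq_fintype_card]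
  refine Nat.card_le_card_of_injective
    (fun g => ⟨g, by
      simp only [injHoms, mem_filter, mem_univ, true_and]
      exact ⟨g.injective, fun i j hij => h (g.map_adj_iff.2 hij)⟩⟩) ?_
  intro g g' hg
  exact DFunLike.coe_injective (Subtype.ext_iff.1 hg)

include hι in
open Classical in
theorem sum_card_injHoms_pickGraph_mul_pow_le {m : ℕ} (F : SimpleGraph (Fin m)) :
    (∑ f : V × Fin d → Fin q, (injHoms F (pickGraph side ι f)).card) * q ^ F.edgeSet.ncard
      ≤ Fintype.card V ^ m * (2 ^ F.edgeSet.ncard * Fintype.card (V × Fin d → Fin q)) := by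
  have h1 : ∑ f : V × Fin d → Fin q, (injHoms F (pickGraph side ι f)).card
      = ∑ φ : Fin m → V, ((univ : Finset (V × Fin d → Fin q)).filter fun f =>
        Function.Injective φ ∧ ∀ i j, F.Adj i j → (pickGraph side ι f).Adj (φ i) (φ j)).card := by
    simp_rw [injHoms, card_filter]
    exact sum_comm
  rw [h1, sum_mul]
  calc _ ≤ ∑ φ : Fin m → V, 2 ^ F.edgeSet.ncard * Fintype.card (V × Fin d → Fin q) := by
        refine Finset.sum_le_sum fun φ _ => ?_
        by_cases hφ : Function.Injective φ
        · simp only [hφ, true_and]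
          convert card_filter_pickGraph_mul_pow_le hι F φ hφ
        · simp [hφ]
    _ = _ := by simp

end PickGraph

end PerturbedCliqueFactor

/-! ### Averaging, and trimming to an exact minimum degree. -/

namespace PerturbedCliqueFactor

open Finset

/-- The number of graphs on the vertex sets `Fin m` with `m ≤ ℓ`. -/
noncomputable def numGraphs (ℓ : ℕ) : ℕ :=
  ∑ m ∈ range (ℓ + 1), Nat.card (SimpleGraph (Fin m))

theorem numGraphs_pos (ℓ : ℕ) : 0 < numGraphs ℓ :=
  sum_pos (fun _ _ => Nat.card_pos) nonempty_range_add_one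

/-- In an edge-minimal subgraph of minimum degree at least `d`, some degree equals `d`; otherwise
any edge could be deleted. -/
theorem exists_minDegree_eq_subgraph {V : Type*} [Finite V] [Nonempty V] {d : ℕ} (hd : 0 < d)
    (H : SimpleGraph V) (hH : ∀ v, d ≤ (H.neighborSet v).ncard) :
    ∃ H' ≤ H, (∀ v, d ≤ (H'.neighborSet v).ncard) ∧ ∃ v, (H'.neighborSet v).ncard = d := by
  obtain ⟨H', hle, hmin⟩ := (Set.toFinite
    {K : SimpleGraph V | ∀ v, d ≤ (K.neighborSet v).ncard}).exists_le_minimal hH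
  refine ⟨H', hle, hmin.prop, ?_⟩
  by_contra! hne
  have hlt : ∀ v, d < (H'.neighborSet v).ncard := fun v =>
    lt_of_le_of_ne (hmin.prop v) (hne v).symm
  obtain ⟨v⟩ := ‹Nonempty V›
  obtain ⟨w, hw⟩ := (Set.ncard_pos (Set.toFinite _)).1 (hd.trans (hlt v))
  have hdel : ∀ u, d ≤ ((H'.deleteEdges {s(v, w)}).neighborSet u).ncard := by
    classical
    intro u
    have hsub : H'.neighborSet u \ {if u = v then w else v}
        ⊆ (H'.deleteEdges {s(v, w)}).neighborSet u := by
      rintro x ⟨hx, hxe⟩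
      simp only [Set.mem_singleton_iff] at hxe
      rw [SimpleGraph.mem_neighborSet, SimpleGraph.deleteEdges_adj]
      refine ⟨hx, fun h => ?_⟩
      rcases Sym2.eq_iff.1 (Set.mem_singleton_iff.1 h) with ⟨h1, h2⟩ | ⟨h1, h2⟩
      · exact hxe (by rw [if_pos h1, h2])
      · split_ifs at hxe with huv
        · exact hxe (by rw [h2, ← huv, h1])
        · exact hxe h2
    have h1 := Set.ncard_le_ncard hsub (Set.toFinite _)
    have h2 := Set.pred_ncard_le_ncard_sdiff_singleton (H'.neighborSet u) (if u = v then w else v)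
    have h3 := hlt u
    omega
  have hle' := hmin.le_of_le hdel (SimpleGraph.deleteEdges_le _)
  have := hle' hw
  rw [SimpleGraph.deleteEdges_adj] at this
  exact this.2 rfl

/-- A bipartite graph of prescribed minimum degree with few copies of all small graphs. -/
theorem exists_isBipartite_card_embedding_le (ℓ : ℕ) {V : Type*} [Fintype V] {d q : ℕ}
    (hd : 0 < d) (hq : 0 < q) (hV : 2 * (d * q) ≤ Fintype.card V) :
    ∃ H : SimpleGraph V, H.IsBipartite ∧ (∀ v, d ≤ (H.neighborSet v).ncard) ∧
      (∃ v, (H.neighborSet v).ncard = d) ∧ ∀ m ≤ ℓ, ∀ F : SimpleGraph (Fin m),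
        (Nat.card (F ↪g H) : ℝ) ≤
          numGraphs ℓ * (Fintype.card V : ℝ) ^ m * (2 / (q : ℝ)) ^ F.edgeSet.ncard := by
  classical
  -- Each side contains `d` disjoint blocks of size `q`, one for each pick; vertices outside all
  -- blocks fall on the side `false` and are never picked.
  obtain ⟨ι⟩ : Nonempty ((Bool × Fin d × Fin q) ↪ V) :=
    Function.Embedding.nonempty_of_card_le (by simpa using hV)
  set side : V → Bool := fun v => decide (∃ x, ι (true, x) = v) with hsidedef
  have hside : ∀ x, side (ι x) = x.1 := by
    rintro ⟨b, x⟩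
    simp only [hsidedef, EmbeddingLike.apply_eq_iff_eq, Prod.mk.injEq]
    cases b <;> simp
  have hNpos : 0 < Fintype.card V := lt_of_lt_of_le (by positivity) hV
  have hVne : Nonempty V := Fintype.card_pos_iff.1 hNpos
  have hN0 : (0 : ℝ) < Fintype.card V := by exact_mod_cast hNpos
  have hq0 : (0 : ℝ) < q := by exact_mod_cast hq
  have hqne : Nonempty (Fin q) := ⟨⟨0, hq⟩⟩
  -- Each count is normalised to have mean at most 1. The sum over all small `F` then has mean at
  -- most `numGraphs ℓ`, and a single `f` is good for every `F` at once.
  let X : (V × Fin d → Fin q) → (Σ m : ℕ, SimpleGraph (Fin m)) → ℝ := fun f F =>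
    ((injHoms F.2 (pickGraph side ι f)).card : ℝ)
      / ((Fintype.card V : ℝ) ^ F.1 * (2 / (q : ℝ)) ^ F.2.edgeSet.ncard)
  let 𝓕 : Finset (Σ m : ℕ, SimpleGraph (Fin m)) := (range (ℓ + 1)).sigma fun _ => univ
  have h𝓕 : 𝓕.card = numGraphs ℓ := by
    simp [𝓕, numGraphs, card_sigma]
  have havg : ∑ f : V × Fin d → Fin q, ∑ F ∈ 𝓕, X f F
      ≤ ∑ _f : V × Fin d → Fin q, (numGraphs ℓ : ℝ) := by
    rw [sum_comm]
    have : ∀ F ∈ 𝓕, ∑ f : V × Fin d → Fin q, X f F ≤ Fintype.card (V × Fin d → Fin q) := by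
      intro F _
      have h := sum_card_injHoms_pickGraph_mul_pow_le (side := side) ι.injective F.2
      have h' : (∑ f : V × Fin d → Fin q, ((injHoms F.2 (pickGraph side ι f)).card : ℝ))
          * (q : ℝ) ^ F.2.edgeSet.ncard ≤ (Fintype.card V : ℝ) ^ F.1 *
            (2 ^ F.2.edgeSet.ncard * Fintype.card (V × Fin d → Fin q)) := by
        exact_mod_cast h
      simp only [X]
      rw [← sum_div, div_le_iff₀ (by positivity), div_pow, mul_div_assoc', mul_div_assoc',
        le_div_iff₀ (by positivity)]
      refine h'.trans (le_of_eq ?_)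
      ring
    refine (sum_le_sum this).trans (le_of_eq ?_)
    rw [sum_const, sum_const, h𝓕, nsmul_eq_mul, nsmul_eq_mul, mul_comm, Finset.card_univ]
  obtain ⟨f, -, hf⟩ := Finset.exists_le_of_sum_le univ_nonempty havg
  obtain ⟨H, hle, hdeg, hdeg'⟩ := exists_minDegree_eq_subgraph hd (pickGraph side ι f)
    (le_ncard_neighborSet_pickGraph ι.injective hside f)
  refine ⟨H, (pickGraph_isBipartite hside f).mono_left hle, hdeg, hdeg', ?_⟩
  intro m hm F
  have hF : X f ⟨m, F⟩ ≤ numGraphs ℓ :=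
    (single_le_sum (f := fun F => X f F) (fun F _ => by positivity)
      (mem_sigma.2 ⟨mem_range.2 (by simpa using Nat.lt_succ_of_le hm), mem_univ F⟩)).trans hf
  simp only [X] at hF
  rw [div_le_iff₀ (by positivity), ← mul_assoc] at hF
  exact le_trans (by exact_mod_cast natCard_embedding_le_card_injHoms F hle) hF

end PerturbedCliqueFactor

/-! ### Expected number of cliques over a pseudorandom graph (`s ≥ 3`). -/

namespace PerturbedCliqueFactor

open Finset MeasureTheory ProbabilityTheory

theorem ncard_edgeSet_add_compl {m : ℕ} (F : SimpleGraph (Fin m)) :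
    F.edgeSet.ncard + Fᶜ.edgeSet.ncard = m.choose 2 := by
  classical
  rw [← Set.ncard_union_eq (SimpleGraph.disjoint_edgeSet.2 disjoint_compl_right)
    (Set.toFinite _) (Set.toFinite _), ← SimpleGraph.edgeSet_sup, sup_compl_eq_top,
    ← SimpleGraph.coe_edgeFinset, Set.ncard_coe_finset,
    SimpleGraph.card_edgeFinset_top_eq_card_choose_two, Fintype.card_fin]

section CliqueCount

variable {V : Type*} [Fintype V] (p : unitInterval) (A : Finset V)

theorem binomialRandom_real_isClique_range_le {W : Type*} {m : ℕ} {G : SimpleGraph V} {H : SimpleGraph W}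
    (F : SimpleGraph (Fin m)) (φ : H ↪g G) (g : F ↪g H) :
    (SimpleGraph.binomialRandom V p).real {R | (G ⊔ R).IsClique (Set.range fun i => φ (g i))}
      ≤ (p : ℝ) ^ Fᶜ.edgeSet.ncard := by
  classical
  have hinj : Function.Injective fun i => φ (g i) := φ.injective.comp g.injective
  have hdiag : ∀ e ∈ Fᶜ.edgeFinset.image (Sym2.map fun i => φ (g i)), ¬ e.IsDiag := by
    intro e he
    obtain ⟨e', he', rfl⟩ := mem_image.1 he
    rw [Sym2.isDiag_map hinj]
    exact SimpleGraph.not_isDiag_of_mem_edgeFinset he'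
  have h := binomialRandom_real_forall_mem p _ hdiag
  rw [card_image_of_injective _ (Sym2.map.injective hinj), ← Set.ncard_coe_finset,
    SimpleGraph.coe_edgeFinset] at h
  rw [← h]
  refine measureReal_mono ?_ (measure_ne_top _ _)
  intro R hR e he
  obtain ⟨e', he', rfl⟩ := mem_image.1 he
  induction e' using Sym2.ind with
  | _ a b =>
    rw [SimpleGraph.mem_edgeFinset, SimpleGraph.mem_edgeSet, SimpleGraph.compl_adj] at he'
    have := hR ⟨a, rfl⟩ ⟨b, rfl⟩ (hinj.ne he'.1)
    rw [SimpleGraph.sup_adj, φ.map_adj_iff, g.map_adj_iff] at this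
    exact this.resolve_left he'.2

/-- Label each `ℓ`-set of `A` and let `F` be the graph that `G` induces on it: the random graph must
supply exactly the non-edges of `F`. Different sets give different embeddings. -/
theorem integral_card_cliquesIn_le {G : SimpleGraph V} (ℓ : ℕ) :
    ∫ R, ((cliquesIn (G ⊔ R) A ℓ).card : ℝ) ∂(SimpleGraph.binomialRandom V p)
      ≤ ∑ F : SimpleGraph (Fin ℓ), (Nat.card (F ↪g G.induce (A : Set V)) : ℝ)
        * (p : ℝ) ^ Fᶜ.edgeSet.ncard := by
  classical
  have hp : (0 : ℝ) ≤ p := p.2.1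
  have hcl : ∀ R : SimpleGraph V, cliquesIn (G ⊔ R) A ℓ
      = (A.powersetCard ℓ).filter fun T : Finset V => (G ⊔ R).IsClique (T : Set V) := by
    intro R
    ext T
    simp [cliquesIn]
  simp_rw [hcl]
  rw [integral_card_filter p (A.powersetCard ℓ) fun T R => (G ⊔ R).IsClique (T : Set V)]
  let E := Σ F : SimpleGraph (Fin ℓ), (F ↪g G.induce (A : Set V))
  have hfin : ∀ F : SimpleGraph (Fin ℓ), Finite (F ↪g G.induce (A : Set V)) := fun F =>
    DFunLike.finite _
  have hfE : ∀ F : SimpleGraph (Fin ℓ), Fintype (F ↪g G.induce (A : Set V)) := fun F =>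
    Fintype.ofFinite _
  have hex : ∀ T : A.powersetCard ℓ, ∃ g : E, Set.range (fun i => (g.2 i : V)) = (T : Set V) := by
    rintro ⟨T, hT⟩
    obtain ⟨hTA, hTc⟩ := mem_powersetCard.1 hT
    let e := (T.equivFinOfCardEq hTc).symm
    let φ : Fin ℓ ↪ (A : Set V) :=
      ⟨fun i => ⟨e i, hTA (e i).2⟩, fun i j h => e.injective (Subtype.ext (by simpa using h))⟩
    refine ⟨⟨(G.induce (A : Set V)).comap φ, SimpleGraph.Embedding.comap φ _⟩, ?_⟩
    ext v
    constructor
    · rintro ⟨i, rfl⟩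
      exact (e i).2
    · intro hv
      exact ⟨e.symm ⟨v, hv⟩, congrArg Subtype.val (e.apply_symm_apply ⟨v, hv⟩)⟩
  choose g hg using hex
  have hginj : Function.Injective g := fun T T' h => by
    have := hg T
    rw [h, hg T'] at this
    exact Subtype.ext (by exact_mod_cast this.symm)
  calc _ = ∑ T : A.powersetCard ℓ, (SimpleGraph.binomialRandom V p).real
          {R | (G ⊔ R).IsClique ((T : Finset V) : Set V)} := by
        rw [← Finset.sum_coe_sort]
    _ ≤ ∑ T : A.powersetCard ℓ, (p : ℝ) ^ (g T).1ᶜ.edgeSet.ncard := by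
        refine Finset.sum_le_sum fun T _ => ?_
        have := binomialRandom_real_isClique_range_le p (g T).1
          (SimpleGraph.Embedding.induce (G := G) (A : Set V)) (g T).2
        rw [← hg T]
        exact this
    _ = ∑ x ∈ univ.map ⟨g, hginj⟩, (p : ℝ) ^ x.1ᶜ.edgeSet.ncard := by
        rw [sum_map]
        rfl
    _ ≤ ∑ x : E, (p : ℝ) ^ x.1ᶜ.edgeSet.ncard :=
        sum_le_univ_sum_of_nonneg fun x => by positivity
    _ = _ := by
        rw [Fintype.sum_sigma]
        refine Finset.sum_congr rfl fun F _ => ?_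
        simp

/-- A factor forces at least `t / r ≥ k / r` cliques of size `s + 1` in `A`, while each pattern `F`
contributes at most a constant times `c * k` to their expected number; Markov's inequality applies.
-/
theorem binomialRandom_real_hasCliqueFactor_le_of_pseudorandom {G : SimpleGraph V}
    {r s m t : ℕ} {L k y c : ℝ} (hs : 1 < s) (hr : 0 < r) (hV : Fintype.card V = r * m)
    (hA : A.card = s * m + t) (hkt : k ≤ t) (hk : 0 < k) (hL : 0 ≤ L) (hy : 0 ≤ y) (hc0 : 0 ≤ c)
    (hc1 : c ≤ 1) (hp : (p : ℝ) = c * y) (hky : k / A.card ≤ r * y)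
    (hk' : (Fintype.card V : ℝ) ^ (s + 1) * y ^ (s + 1).choose 2 ≤ k)
    (hG : IsPseudorandomBipartite (G.induce (A : Set V)) (s + 1) L k) :
    (SimpleGraph.binomialRandom V p).real {R | HasCliqueFactor r (G ⊔ R)}
      ≤ r * (Fintype.card (SimpleGraph (Fin (s + 1))) * (L * r ^ (s + 1).choose 2)) * c := by
  classical
  have hr1 : (1 : ℝ) ≤ r := by exact_mod_cast hr
  have hterm : ∀ F : SimpleGraph (Fin (s + 1)), (Nat.card (F ↪g G.induce (A : Set V)) : ℝ)
        * (p : ℝ) ^ Fᶜ.edgeSet.ncard ≤ L * r ^ (s + 1).choose 2 * c * k := by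
    intro F
    rcases isEmpty_or_nonempty (F ↪g G.induce (A : Set V)) with he | ⟨⟨g⟩⟩
    · rw [Nat.card_of_isEmpty, Nat.cast_zero, zero_mul]
      positivity
    have hbip : F.Colorable 2 := SimpleGraph.Colorable.of_hom g.toHom hG.bipartite
    -- A complete `F` on `s + 1 ≥ 3` vertices is not 2-colourable. Some edge must therefore be
    -- random, which provides the decisive factor `c`.
    have hpos : Fᶜ.edgeSet.ncard ≠ 0 := by
      intro h0
      rw [Set.ncard_eq_zero (Set.toFinite _), SimpleGraph.edgeSet_eq_empty, compl_eq_bot] at h0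
      obtain ⟨C⟩ := hbip
      have hinj : Function.Injective C := fun i j hij => by
        by_contra hne
        exact C.valid (v := i) (w := j) (by rw [h0]; exact hne) hij
      have := Fintype.card_le_of_injective C hinj
      simp only [Fintype.card_fin] at this
      omega
    have hcard := hG.card_embedding_le (s + 1) le_rfl F
    have hAc : Nat.card ((A : Set V) : Type _) = A.card := by simp
    rw [hAc] at hcard
    have hAn : (A.card : ℝ) ≤ Fintype.card V := by exact_mod_cast card_le_univ A
    have hc : c ^ Fᶜ.edgeSet.ncard ≤ c := pow_le_of_le_one hc0 hc1 hpos
    have he := ncard_edgeSet_add_compl F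
    have hre : (r : ℝ) ^ F.edgeSet.ncard ≤ r ^ (s + 1).choose 2 :=
      pow_le_pow_right₀ hr1 (by omega)
    calc _ ≤ L * (A.card : ℝ) ^ (s + 1) * (k / A.card) ^ F.edgeSet.ncard
            * (c * y) ^ Fᶜ.edgeSet.ncard := by
          rw [hp]
          exact mul_le_mul_of_nonneg_right hcard (by positivity)
      _ ≤ L * (Fintype.card V : ℝ) ^ (s + 1) * (r * y) ^ F.edgeSet.ncard
            * (c * y) ^ Fᶜ.edgeSet.ncard := by gcongr
      _ = L * r ^ F.edgeSet.ncard * c ^ Fᶜ.edgeSet.ncard *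
            ((Fintype.card V : ℝ) ^ (s + 1) * y ^ (s + 1).choose 2) := by
          rw [← he, pow_add, mul_pow, mul_pow]
          ring
      _ ≤ L * r ^ (s + 1).choose 2 * c * k := by gcongr
  have hint := (integral_card_cliquesIn_le p A (G := G) (s + 1)).trans
    (Finset.sum_le_sum fun F _ => hterm F)
  rw [sum_const, nsmul_eq_mul, Finset.card_univ] at hint
  have hmark := mul_meas_ge_le_integral_of_nonneg (μ := SimpleGraph.binomialRandom V p)
    (f := fun R => ((cliquesIn (G ⊔ R) A (s + 1)).card : ℝ))
    (Filter.Eventually.of_forall fun R => Nat.cast_nonneg _) Integrable.of_finite (k / r)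
  have hsub : {R | HasCliqueFactor r (G ⊔ R)} ⊆
      {R | k / r ≤ ((cliquesIn (G ⊔ R) A (s + 1)).card : ℝ)} := by
    intro R hR
    have h := hR.add_card_isolated_le hs hV hr A ∅ hA (empty_subset _) (by simp)
    rw [card_empty, add_zero] at h
    have h' : (t : ℝ) ≤ r * (cliquesIn (G ⊔ R) A (s + 1)).card := by exact_mod_cast h
    simp only [Set.mem_ofPred_eq]
    rw [div_le_iff₀ (by linarith)]
    linarith
  refine (measureReal_mono hsub (measure_ne_top _ _)).trans ?_
  have h := hmark.trans hint
  rw [← le_div_iff₀' (by positivity)] at h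
  refine h.trans (le_of_eq ?_)
  field_simp

end CliqueCount

end PerturbedCliqueFactor

/-! ### The deterministic graphs, their minimum degrees, and the exponent. -/

namespace PerturbedCliqueFactor

open Finset MeasureTheory ProbabilityTheory

theorem not_hasCliqueFactor_of_independent {V : Type*} [Fintype V] {G : SimpleGraph V}
    {r s m : ℕ} (hs : 1 < s) (hr : 0 < r) (hm : 0 < m) (hV : Fintype.card V = r * m)
    (A : Finset V) (hA : A.card = s * m) (hind : ∀ u ∈ A, ∀ v ∈ A, ¬ G.Adj u v) :
    ¬ HasCliqueFactor r G := by
  classical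
  intro h
  have h1 := h.add_card_isolated_le (t := 0) hs hV hr A A hA Subset.rfl hind
  have h2 : cliquesIn G A (s + 1) = ∅ := by
    refine filter_eq_empty_iff.2 fun T hT hcl => ?_
    obtain ⟨hTA, hTc⟩ := mem_powersetCard.1 hT
    obtain ⟨u, hu, v, hv, huv⟩ := one_lt_card.1 (by omega : 1 < T.card)
    exact hind u (hTA hu) v (hTA hv) (hcl hu hv huv)
  rw [h2, card_empty, mul_zero, hA] at h1
  have : 0 < s * m := by positivity
  omega

theorem minDegree_eq_of_ncard {V : Type*} [Fintype V] [Nonempty V] {G : SimpleGraph V}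
    [DecidableRel G.Adj] {D : ℕ} (h : ∀ v, D ≤ (G.neighborSet v).ncard)
    (h' : ∃ v, (G.neighborSet v).ncard = D) : G.minDegree = D := by
  have hdeg : ∀ v, G.degree v = (G.neighborSet v).ncard := fun v => by
    rw [← SimpleGraph.card_neighborSet_eq_degree, ← Nat.card_eq_fintype_card,
      Nat.card_coe_set_eq]
  obtain ⟨v, hv⟩ := h'
  refine le_antisymm ?_ (G.le_minDegree_of_forall_le_degree _ fun w => (hdeg w).symm ▸ h w)
  rw [← hv, ← hdeg]
  exact G.minDegree_le_degree v

section JoinComplete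

variable {V : Type*} (A : Finset V) (H : SimpleGraph (A : Set V))

/-- The graph which is `H` on `A` and in which all pairs not inside `A` are adjacent. -/
def joinComplete : SimpleGraph V where
  Adj u v := u ≠ v ∧ ∀ (hu : u ∈ (A : Set V)) (hv : v ∈ (A : Set V)), H.Adj ⟨u, hu⟩ ⟨v, hv⟩
  symm := ⟨fun _ _ h => ⟨h.1.symm, fun hu hv => (h.2 hv hu).symm⟩⟩
  loopless := ⟨fun _ h => h.1 rfl⟩

theorem joinComplete_adj_of_not_mem {u v : V} (huv : u ≠ v) (h : ¬ (u ∈ A ∧ v ∈ A)) :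
    (joinComplete A H).Adj u v :=
  ⟨huv, fun hu hv => absurd ⟨hu, hv⟩ h⟩

theorem joinComplete_adj_of_mem {u v : V} (hu : u ∈ (A : Set V)) (hv : v ∈ (A : Set V)) :
    (joinComplete A H).Adj u v ↔ H.Adj ⟨u, hu⟩ ⟨v, hv⟩ :=
  ⟨fun h => h.2 hu hv, fun h => ⟨fun e => h.ne (Subtype.ext e), fun _ _ => h⟩⟩

theorem induce_joinComplete : (joinComplete A H).induce (A : Set V) = H := by
  ext u v
  exact joinComplete_adj_of_mem A H u.2 v.2

/-- A vertex of `A` has its `H`-degree plus `|V| - b - t`, so the minimum `t` cancels. Vertices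
outside `A` have degree `|V| - 1`, which is no smaller because `b > 0`. -/
theorem minDegree_joinComplete [Fintype V] [DecidableRel (joinComplete A H).Adj] {b t : ℕ}
    (hb : 0 < b) (hA : A.card = b + t) (hdeg : ∀ v, t ≤ (H.neighborSet v).ncard)
    (hdeg' : ∃ v, (H.neighborSet v).ncard = t) :
    (joinComplete A H).minDegree = Fintype.card V - b := by
  classical
  have hAV : A.card ≤ Fintype.card V := card_le_univ A
  have hcompl : ((A : Set V)ᶜ).ncard = Fintype.card V - A.card := by
    rw [← coe_compl, Set.ncard_coe_finset, card_compl]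
  have hmem : ∀ v (hv : v ∈ (A : Set V)), ((joinComplete A H).neighborSet v).ncard
      = Fintype.card V - A.card + (H.neighborSet ⟨v, hv⟩).ncard := by
    intro v hv
    have heq : (joinComplete A H).neighborSet v
        = (A : Set V)ᶜ ∪ Subtype.val '' H.neighborSet ⟨v, hv⟩ := by
      ext u
      by_cases hu : u ∈ (A : Set V)
      · have := joinComplete_adj_of_mem A H hv hu
        simp only [SimpleGraph.mem_neighborSet, this, Set.mem_union, Set.mem_compl_iff, hu,
          not_true, false_or, Set.mem_image, Subtype.exists, exists_and_right, exists_eq_right,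
          exists_true_left]
      · simp only [SimpleGraph.mem_neighborSet, Set.mem_union, Set.mem_compl_iff, hu,
          not_false_iff, true_or, iff_true]
        exact joinComplete_adj_of_not_mem A H (fun h => hu (h ▸ hv)) fun h => hu h.2
    rw [heq, Set.ncard_union_eq _ (Set.toFinite _) (Set.toFinite _), hcompl,
      Set.ncard_image_of_injective _ Subtype.val_injective]
    rw [Set.disjoint_left]
    rintro u hu ⟨w, _, rfl⟩
    exact hu w.2
  obtain ⟨v₀, hv₀⟩ := hdeg'
  have : Nonempty V := ⟨v₀⟩
  refine minDegree_eq_of_ncard (fun v => ?_) ⟨v₀, ?_⟩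
  · by_cases hv : v ∈ (A : Set V)
    · rw [hmem v hv]
      have := hdeg ⟨v, hv⟩
      omega
    · have heq : (joinComplete A H).neighborSet v = {v}ᶜ := by
        ext u
        simp only [SimpleGraph.mem_neighborSet, Set.mem_compl_iff, Set.mem_singleton_iff]
        exact ⟨fun h => h.1.symm,
          fun h => joinComplete_adj_of_not_mem A H (Ne.symm h) fun h => hv h.1⟩
      rw [heq, Set.ncard_compl, Set.ncard_singleton, Nat.card_eq_fintype_card]
      omega
  · rw [hmem v₀ v₀.2, hv₀]
    omega

end JoinComplete

section Multipartite

theorem sum_classSize {r m : ℕ} (hr : 0 < r) :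
    ∑ i : Fin ((r + 1) / 2), classSize r (r * m) i = r * m := by
  simp only [classSize, Nat.mul_div_cancel_left m hr]
  rw [Fin.sum_univ_eq_sum_range (fun i => if i < r / 2 then 2 * m else m) ((r + 1) / 2)]
  have h0 : ∀ h, ∑ i ∈ range h, (if i < h then 2 * m else m) = h * (2 * m) := fun h => by
    rw [Finset.sum_congr rfl (g := fun _ => 2 * m), sum_const, card_range, smul_eq_mul]
    intro i hi
    rw [if_pos (mem_range.1 hi)]
  rcases Nat.even_or_odd' r with ⟨h, rfl | rfl⟩
  · have h1 : (2 * h + 1) / 2 = h := by omega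
    have h2 : 2 * h / 2 = h := by omega
    rw [h1, h2, h0]
    ring
  · have h1 : (2 * h + 1 + 1) / 2 = h + 1 := by omega
    have h2 : (2 * h + 1) / 2 = h := by omega
    rw [h1, h2, sum_range_succ, h0, if_neg (lt_irrefl h)]
    ring

/-- The complete multipartite graph of the case `s = 2`, on the vertex set `Fin n`. -/
theorem exists_multipartite {r m : ℕ} (hr : 2 < r) (hm : 0 < m) :
    ∃ G : SimpleGraph (Fin (r * m)),
      (∃ _ : DecidableRel G.Adj, G.minDegree = r * m - 2 * m) ∧
      Nonempty (G ≃g SimpleGraph.completeMultipartiteGraph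
        (fun i : Fin ((r + 1) / 2) => Fin (classSize r (r * m) i))) ∧
      ∃ A : Finset (Fin (r * m)), A.card = 2 * m ∧ ∀ u ∈ A, ∀ v ∈ A, ¬ G.Adj u v := by
  classical
  have hr0 : 0 < r := by omega
  let e : Fin (r * m) ≃ Σ i : Fin ((r + 1) / 2), Fin (classSize r (r * m) i) :=
    Fintype.equivOfCardEq (by simp [sum_classSize hr0])
  let i₀ : Fin ((r + 1) / 2) := ⟨0, by omega⟩
  have hi₀ : classSize r (r * m) i₀ = 2 * m := by
    rw [classSize, if_pos (by simp [i₀]; omega), Nat.mul_div_cancel_left m hr0]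
  have hle : ∀ i, classSize r (r * m) i ≤ 2 * m := by
    intro i
    rw [classSize, Nat.mul_div_cancel_left m hr0]
    split_ifs <;> omega
  have hfiber : ∀ i, (univ.filter fun u => (e u).1 = i).card = classSize r (r * m) i := by
    intro i
    have : (univ.filter fun u => (e u).1 = i).map e.toEmbedding
        = (univ : Finset (Fin (classSize r (r * m) i))).map ⟨Sigma.mk i, sigma_mk_injective⟩ := by
      ext ⟨j, x⟩
      simp only [mem_filter, mem_univ, true_and, mem_map]
      constructor
      · rintro ⟨a, rfl, ha⟩
        have h1 : (e a).1 = j := congrArg Sigma.fst ha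
        rw [h1]
        exact ⟨x, rfl⟩
      · rintro ⟨a, ha⟩
        exact ⟨e.symm ⟨j, x⟩, by simpa using (congrArg Sigma.fst ha).symm, by simp⟩
    have := congrArg card this
    simpa only [card_map, card_univ, Fintype.card_fin] using this
  let M := SimpleGraph.completeMultipartiteGraph
        (fun i : Fin ((r + 1) / 2) => Fin (classSize r (r * m) i))
  refine ⟨M.comap e, ⟨inferInstance, ?_⟩, ⟨SimpleGraph.Iso.comap e M⟩,
    univ.filter fun u => (e u).1 = i₀, (hfiber i₀).trans hi₀, ?_⟩
  · have hnb : ∀ v, ((M.comap e).neighborSet v).ncard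
        = r * m - classSize r (r * m) (e v).1 := by
      intro v
      have : (M.comap e).neighborSet v
          = (((univ.filter fun u => (e u).1 = (e v).1)ᶜ : Finset (Fin (r * m))) : Set _) := by
        ext u
        simp [M, SimpleGraph.completeMultipartiteGraph, eq_comm]
      rw [this, Set.ncard_coe_finset, card_compl, hfiber, Fintype.card_fin]
    have : Nonempty (Fin (r * m)) := ⟨⟨0, by positivity⟩⟩
    refine minDegree_eq_of_ncard (fun v => ?_) ⟨e.symm ⟨i₀, ⟨0, by omega⟩⟩, ?_⟩
    · rw [hnb]
      have := hle (e v).1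
      omega
    · rw [hnb, Equiv.apply_symm_apply, hi₀]
  · intro u hu v hv huv
    exact huv ((mem_filter.1 hu).2.trans (mem_filter.1 hv).2.symm)

end Multipartite

theorem natCast_sub_mul_eq {r s m : ℕ} (hr : 0 < r) (hsr : s ≤ r) :
    ((r * m - s * m : ℕ) : ℝ) = (1 - (s : ℝ) / r) * ((r * m : ℕ) : ℝ) := by
  have : (r : ℝ) ≠ 0 := by exact_mod_cast hr.ne'
  rw [Nat.cast_sub (Nat.mul_le_mul_right m hsr)]
  push_cast
  field_simp

theorem phi_pos {s : ℕ} (hs : 3 ≤ s) : 0 < phi s := by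
  have : (3 : ℝ) ≤ s := by exact_mod_cast hs
  exact div_pos (by linarith) (mul_pos (by linarith) (by linarith))

/-- At `s = 2` the value is exactly 1, so `k` would not grow. -/
theorem phi_lt_one {s : ℕ} (hs : 3 ≤ s) : phi s < 1 := by
  have : (3 : ℝ) ≤ s := by exact_mod_cast hs
  rw [phi, div_lt_one (mul_pos (by linarith) (by linarith))]
  nlinarith

/-- The equation that dictates `φ`: the expected clique count `n^(s+1) p^((s+1).choose 2)` at `p =
n^(-φ)` equals `k = n^(1-φ)`. -/
theorem phi_mul_choose {s : ℕ} (hs : 3 ≤ s) :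
    (s + 1 : ℕ) - phi s * ((s + 1).choose 2 : ℕ) = 1 - phi s := by
  have h : (3 : ℝ) ≤ s := by exact_mod_cast hs
  have h1 : (s : ℝ) - 1 ≠ 0 := by linarith
  have h2 : (s : ℝ) + 2 ≠ 0 := by linarith
  rw [Nat.cast_choose_two, phi]
  push_cast
  field_simp
  ring

end PerturbedCliqueFactor

/-! ### Choice of the constants, and the pseudorandom graph. -/

namespace PerturbedCliqueFactor

open Finset MeasureTheory ProbabilityTheory

theorem pThreshold_two (n : ℕ) : pThreshold 2 n = Real.log n / n := if_pos rfl

theorem pThreshold_of_three_le {s : ℕ} (hs : 3 ≤ s) (n : ℕ) :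
    pThreshold s n = (n : ℝ) ^ (-phi s) := if_neg (by omega)

theorem pThreshold_nonneg {s n : ℕ} (hn : 0 < n) : 0 ≤ pThreshold s n := by
  have : (1 : ℝ) ≤ n := by exact_mod_cast hn
  have := Real.log_nonneg this
  unfold pThreshold
  split_ifs <;> positivity

theorem pThreshold_le_one {s n : ℕ} (hs : 1 < s) (hn : 0 < n) : pThreshold s n ≤ 1 := by
  have h1 : (1 : ℝ) ≤ n := by exact_mod_cast hn
  rcases Nat.lt_or_ge 2 s with h | h
  · rw [pThreshold_of_three_le h]
    exact Real.rpow_le_one_of_one_le_of_nonpos h1 (by linarith [phi_pos h])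
  · obtain rfl : s = 2 := by omega
    rw [pThreshold_two, div_le_one (by linarith)]
    linarith [Real.log_le_sub_one_of_pos (by linarith : (0 : ℝ) < n)]

/-- The edge probability `c * pThreshold s n` as a point of the unit interval. -/
noncomputable def edgeProb (s n : ℕ) (hs : 1 < s) (hn : 0 < n) (c : ℝ) (hc0 : 0 ≤ c) (hc1 : c ≤ 1) :
    unitInterval :=
  ⟨c * pThreshold s n, mul_nonneg hc0 (pThreshold_nonneg hn),
    mul_le_one₀ hc1 (pThreshold_nonneg hn) (pThreshold_le_one hs hn)⟩

/-- A constant `c` serving both the bounded and the large values of `n`. -/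
theorem exists_small_constant {ε b : ℝ} (hε : 0 < ε) (hb : 0 ≤ b) :
    ∃ c : ℝ, 0 < c ∧ c ≤ 1 / 8 ∧ b * c < ε := by
  refine ⟨min (1 / 8) (ε / (b + 1)), by positivity, min_le_left _ _, ?_⟩
  calc b * min (1 / 8) (ε / (b + 1)) ≤ b * (ε / (b + 1)) := by gcongr; exact min_le_right _ _
    _ < ε := by
      rw [mul_div_assoc', div_lt_iff₀ (by linarith)]
      nlinarith

theorem real_hasCliqueFactor_sup_lt_of_lt {n n₁ r s : ℕ} {G : SimpleGraph (Fin n)} {p : unitInterval}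
    {c b ε : ℝ} (hs : 1 < s) (hn : 0 < n) (hn₁ : n < n₁) (hc : 0 ≤ c) (hb : (n₁ : ℝ) ^ 2 ≤ b)
    (hbc : b * c < ε) (hp : (p : ℝ) = c * pThreshold s n) (hG : ¬ HasCliqueFactor r G) :
    (SimpleGraph.binomialRandom (Fin n) p).real {R | HasCliqueFactor r (G ⊔ R)} < ε := by
  have hle : (n : ℝ) ≤ n₁ := by exact_mod_cast hn₁.le
  calc _ ≤ _ := binomialRandom_real_hasCliqueFactor_sup_le p hG
    _ ≤ (n₁ : ℝ) ^ 2 * (c * 1) := by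
      rw [Fintype.card_fin, hp]
      gcongr
      · exact mul_nonneg hc (pThreshold_nonneg hn)
      · exact pThreshold_le_one hs hn
    _ ≤ b * c := by rw [mul_one]; gcongr
    _ < ε := hbc

/-- Equivalent to `2k ≤ n / r`, which makes `A` fit into the vertex set and `H` fit onto `A`. -/
theorem exists_threshold_for_embedding {s : ℕ} (hs : 3 ≤ s) (r : ℕ) :
    ∃ n₀ : ℕ, ∀ n : ℕ, n₀ ≤ n → 2 * (r : ℝ) ≤ (n : ℝ) ^ phi s := by
  have := ((tendsto_rpow_atTop (phi_pos hs)).comp tendsto_natCast_atTop_atTop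
    (α := ℕ)).eventually_ge_atTop (2 * (r : ℝ))
  exact Filter.eventually_atTop.1 this

/-- The pseudorandom bipartite graphs of the case `s ≥ 3`. -/
theorem exists_isPseudorandomBipartite (s : ℕ) :
    ∃ L : ℝ, 0 < L ∧ ∀ (W : Type) (_ : Fintype W) (k : ℝ), 1 ≤ k →
      2 * ⌈k⌉₊ ≤ Fintype.card W → ∃ H : SimpleGraph W,
        IsPseudorandomBipartite H (s + 1) L k ∧ (∀ v, ⌈k⌉₊ ≤ (H.neighborSet v).ncard) ∧
        ∃ v, (H.neighborSet v).ncard = ⌈k⌉₊ := by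
  have hK : (0 : ℝ) < numGraphs (s + 1) := by exact_mod_cast numGraphs_pos _
  -- With `N = |W|`, rounding gives `N ≤ 4dq` and `d ≤ 2k`, hence `2 / q ≤ 16 k / N`; and `F` has at
  -- most `(s + 1)^2` edges.
  refine ⟨numGraphs (s + 1) * 16 ^ (s + 1) ^ 2, by positivity, ?_⟩
  intro W _ k hk hW
  set d := ⌈k⌉₊ with hd
  have hd0 : 0 < d := Nat.ceil_pos.2 (by linarith)
  set q := Fintype.card W / (2 * d) with hq
  have hq0 : 0 < q := Nat.div_pos hW (by positivity)
  have hqW : 2 * (d * q) ≤ Fintype.card W := by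
    rw [← mul_assoc]
    exact Nat.mul_div_le _ _
  obtain ⟨H, hbip, hdeg, hdeg', hemb⟩ := exists_isBipartite_card_embedding_le (s + 1) hd0 hq0 hqW
  refine ⟨H, ⟨hbip, fun v => (Nat.le_ceil k).trans (by exact_mod_cast hdeg v), ?_⟩, hdeg, hdeg'⟩
  intro m hm F
  refine (hemb m hm F).trans ?_
  rw [Nat.card_eq_fintype_card]
  have hN0 : 0 < Fintype.card W := by omega
  have hN : (0 : ℝ) < Fintype.card W := by exact_mod_cast hN0
  have hqR : (0 : ℝ) < q := by exact_mod_cast hq0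
  have hdk : (d : ℝ) ≤ 2 * k := by
    have := Nat.ceil_lt_add_one (by linarith : 0 ≤ k)
    linarith
  have h2q : 2 / (q : ℝ) ≤ 16 * (k / Fintype.card W) := by
    have h1 : Fintype.card W < 2 * d * (q + 1) := by
      rw [mul_comm]
      exact Nat.lt_mul_of_div_lt (Nat.lt_succ_self _) (by positivity)
    have h2 : Fintype.card W ≤ 4 * (d * q) := by nlinarith
    have h3 : (Fintype.card W : ℝ) ≤ 4 * (d * q) := by exact_mod_cast h2
    rw [mul_div_assoc', div_le_div_iff₀ hqR hN]
    nlinarith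
  have he : F.edgeSet.ncard ≤ (s + 1) ^ 2 := by
    have h1 := ncard_edgeSet_add_compl F
    have h2 := Nat.choose_le_pow m 2
    have h3 := Nat.pow_le_pow_left hm 2
    omega
  calc _ ≤ (numGraphs (s + 1) : ℝ) * (Fintype.card W : ℝ) ^ m *
        (16 * (k / Fintype.card W)) ^ F.edgeSet.ncard := by gcongr
    _ = numGraphs (s + 1) * 16 ^ F.edgeSet.ncard * (Fintype.card W : ℝ) ^ m *
        (k / Fintype.card W) ^ F.edgeSet.ncard := by rw [mul_pow]; ring
    _ ≤ _ := by
      gcongr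
      norm_num

end PerturbedCliqueFactor

/-! ### Assembly of the two cases. -/

open PerturbedCliqueFactor in
theorem exists_graph_of_eq_two (r : ℕ) (hr : 2 < r) (ε : ℝ) (hε : 0 < ε) : ∃ c : ℝ, 0 < c ∧
      ∀ n : ℕ, 0 < n → r ∣ n →
        ∃ (G : SimpleGraph (Fin n)) (_ : DecidableRel G.Adj),
          (G.minDegree : ℝ) = (1 - ((2 : ℕ) : ℝ) / (r : ℝ)) * (n : ℝ) ∧
          (∃ p : unitInterval, (p : ℝ) = c * pThreshold 2 n ∧
            (SimpleGraph.binomialRandom (Fin n) p).real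
              {R : SimpleGraph (Fin n) | HasCliqueFactor r (G ⊔ R)} < ε) ∧
          Nonempty (G ≃g SimpleGraph.completeMultipartiteGraph
            (fun i : Fin ((r + 1) / 2) => Fin (classSize r n i))) := by
  obtain ⟨n₁, hn₁⟩ := exists_isolated_bound_lt r hr hε
  obtain ⟨c, hc0, hc8, hcε⟩ := exists_small_constant hε (sq_nonneg (n₁ : ℝ))
  refine ⟨c, hc0, ?_⟩
  rintro n hn ⟨m, rfl⟩
  have hr0 : 0 < r := by omega
  have hm : 0 < m := Nat.pos_of_mul_pos_left hn
  obtain ⟨G, ⟨hdec, hdeg⟩, hiso, A, hA, hind⟩ := exists_multipartite hr hm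
  have hV : Fintype.card (Fin (r * m)) = r * m := Fintype.card_fin _
  refine ⟨G, hdec, ?_, ⟨edgeProb 2 (r * m) (by norm_num) hn c hc0.le (by linarith), rfl, ?_⟩, hiso⟩
  · rw [hdeg, natCast_sub_mul_eq hr0 hr.le]
  rcases lt_or_ge (r * m) n₁ with hlt | hge
  · exact real_hasCliqueFactor_sup_lt_of_lt (by norm_num) hn hlt hc0.le le_rfl hcε rfl
      (not_hasCliqueFactor_of_independent (by norm_num) hr0 hm hV A hA hind)
  · have hp1 : c * pThreshold 2 (r * m) < 1 := by
      have h1 := pThreshold_le_one (s := 2) (by norm_num) hn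
      have h2 := pThreshold_nonneg (s := 2) hn
      nlinarith
    refine (binomialRandom_real_hasCliqueFactor_le_of_independent _ A hind hr0 hm hV hA
      hp1).trans_lt ?_
    exact hn₁ m c (r * m) hge (by push_cast; ring) hc0 hc8 A.card (by rw [hA]; push_cast; ring)
      (c * pThreshold 2 (r * m)) (by rw [pThreshold_two])

open PerturbedCliqueFactor in
theorem exists_graph_of_three_le (s : ℕ) (hs : 3 ≤ s) :
    ∃ L : ℝ, 0 < L ∧ ∀ r : ℕ, s < r → ∃ n₀ : ℕ, ∀ ε : ℝ, 0 < ε → ∃ c : ℝ, 0 < c ∧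
      ∀ n : ℕ, 0 < n → r ∣ n →
        ∃ (G : SimpleGraph (Fin n)) (_ : DecidableRel G.Adj),
          (G.minDegree : ℝ) = (1 - (s : ℝ) / (r : ℝ)) * (n : ℝ) ∧
          (∃ p : unitInterval, (p : ℝ) = c * pThreshold s n ∧
            (SimpleGraph.binomialRandom (Fin n) p).real
              {R : SimpleGraph (Fin n) | HasCliqueFactor r (G ⊔ R)} < ε) ∧
          (n₀ ≤ n → ∃ A : Finset (Fin n),
            A.card = s * (n / r) + ⌈(n : ℝ) ^ (1 - phi s)⌉₊ ∧
            (∀ u v : Fin n, u ≠ v → ¬ (u ∈ A ∧ v ∈ A) → G.Adj u v) ∧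
            IsPseudorandomBipartite (G.induce (A : Set (Fin n)))
              (s + 1) L ((n : ℝ) ^ (1 - phi s))) := by
  classical
  obtain ⟨L, hL, hps⟩ := exists_isPseudorandomBipartite s
  refine ⟨L, hL, fun r hsr => ?_⟩
  obtain ⟨n₀, hn₀⟩ := exists_threshold_for_embedding hs r
  refine ⟨n₀, fun ε hε => ?_⟩
  set B : ℝ := r * (Fintype.card (SimpleGraph (Fin (s + 1))) * (L * r ^ (s + 1).choose 2)) with hB
  have hB0 : 0 ≤ B := by positivity
  -- The summand `B` serves `n ≥ n₀` and the summand `n₀ ^ 2` serves `n < n₀`.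
  obtain ⟨c, hc0, hc8, hcε⟩ := exists_small_constant hε (add_nonneg hB0 (sq_nonneg (n₀ : ℝ)))
  refine ⟨c, hc0, ?_⟩
  rintro n hn ⟨m, rfl⟩
  have hr0 : 0 < r := by omega
  have hm : 0 < m := Nat.pos_of_mul_pos_left hn
  have hV : Fintype.card (Fin (r * m)) = r * m := Fintype.card_fin _
  have hsm : 0 < s * m := by positivity
  rcases lt_or_ge (r * m) n₀ with hlt | hge
  · obtain ⟨A, -, hA⟩ := Finset.exists_subset_card_eq
      (s := (Finset.univ : Finset (Fin (r * m)))) (n := s * m)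
      (by rw [Finset.card_univ, hV]; exact Nat.mul_le_mul_right m hsr.le)
    have hAne : A.Nonempty := Finset.card_pos.1 (hA ▸ hsm)
    obtain ⟨a, ha⟩ := hAne
    -- For small `n`, `A` is an independent set of size exactly `s * m`: the minimum degree is right
    -- and there is no factor without random edges.
    refine ⟨joinComplete A ⊥, Classical.decRel _, ?_,
      ⟨edgeProb s (r * m) (by omega) hn c hc0.le (by linarith), rfl, ?_⟩,
      fun h => absurd hlt (not_lt.2 h)⟩
    · rw [minDegree_joinComplete A ⊥ (t := 0) hsm hA (fun _ => Nat.zero_le _)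
        ⟨⟨a, ha⟩, by simp [SimpleGraph.neighborSet]⟩, hV, natCast_sub_mul_eq hr0 hsr.le]
    · refine real_hasCliqueFactor_sup_lt_of_lt (by omega) hn hlt hc0.le
        (le_add_of_nonneg_left hB0) hcε rfl
        (not_hasCliqueFactor_of_independent (by omega) hr0 hm hV A hA ?_)
      intro u hu v hv h
      exact (joinComplete_adj_of_mem A ⊥ hu hv).1 h
  · set x : ℝ := ((r * m : ℕ) : ℝ) with hx
    have hx1 : 1 ≤ x := Nat.one_le_cast.2 hn
    have hx0 : 0 < x := by linarith
    have hrm : x = r * m := by rw [hx]; push_cast; ring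
    have hr0' : (0 : ℝ) < r := by exact_mod_cast hr0
    have hm0' : (0 : ℝ) < m := by exact_mod_cast hm
    set k : ℝ := x ^ (1 - phi s) with hk
    have hk1 : 1 ≤ k := Real.one_le_rpow hx1 (by linarith [phi_lt_one hs])
    have hkx : k = x * x ^ (-phi s) := by
      rw [hk, sub_eq_add_neg, Real.rpow_add hx0, Real.rpow_one]
    have hy0 : 0 < x ^ (-phi s) := Real.rpow_pos_of_pos hx0 _
    have hkm : 2 * k ≤ m := by
      have h1 : x ^ phi s * x ^ (-phi s) = 1 := by
        rw [← Real.rpow_add hx0, add_neg_cancel, Real.rpow_zero]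
      have h2 := hn₀ (r * m) hge
      have h3 : 2 * (r : ℝ) * x ^ (-phi s) ≤ 1 := by
        rw [← h1]
        gcongr
      rw [hkx, hrm] at *
      nlinarith
    have hdm : ⌈k⌉₊ ≤ m := by
      have h1 := Nat.ceil_lt_add_one (by linarith : 0 ≤ k)
      have h2 : (⌈k⌉₊ : ℝ) < m + 1 := by linarith
      exact Nat.lt_succ_iff.1 (by exact_mod_cast h2)
    obtain ⟨A, -, hA⟩ := Finset.exists_subset_card_eq
      (s := (Finset.univ : Finset (Fin (r * m)))) (n := s * m + ⌈k⌉₊)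
      (by rw [Finset.card_univ, hV]; nlinarith)
    obtain ⟨H, hH, hdeg, hdeg'⟩ := hps ((A : Set (Fin (r * m))) : Type) inferInstance k hk1
      (by simp only [Finset.coe_sort_coe, Fintype.card_coe, hA]; nlinarith)
    have hind : IsPseudorandomBipartite ((joinComplete A H).induce (A : Set (Fin (r * m))))
        (s + 1) L k := by
      rw [induce_joinComplete]
      exact hH
    refine ⟨joinComplete A H, Classical.decRel _, ?_,
      ⟨edgeProb s (r * m) (by omega) hn c hc0.le (by linarith), rfl, ?_⟩, fun _ => ⟨A, ?_,
        fun u v huv h => joinComplete_adj_of_not_mem A H huv h, hind⟩⟩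
    · rw [minDegree_joinComplete A H hsm hA hdeg hdeg', hV, natCast_sub_mul_eq hr0 hsr.le]
    · refine (binomialRandom_real_hasCliqueFactor_le_of_pseudorandom _ A (by omega) hr0 hV hA
        (Nat.le_ceil k) (by linarith) hL.le hy0.le hc0.le (by linarith)
        (show _ = c * x ^ (-phi s) from ?_) ?_ ?_ hind).trans_lt ?_
      · rw [← pThreshold_of_three_le hs]
        rfl
      · have hAm : (m : ℝ) ≤ A.card := by
          have : m ≤ A.card := by rw [hA]; nlinarith
          exact_mod_cast this
        rw [div_le_iff₀ (by linarith), hkx, hrm]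
        rw [hrm] at hy0
        calc (r : ℝ) * m * (r * m) ^ (-phi s) = r * (r * m) ^ (-phi s) * m := by ring
          _ ≤ _ := by gcongr
      -- By `phi_mul_choose` this bound is an equality.
      · rw [hV, ← hx, ← Real.rpow_natCast, ← Real.rpow_natCast (x ^ (-phi s)),
          ← Real.rpow_mul hx0.le, ← Real.rpow_add hx0, hk, ← phi_mul_choose hs, neg_mul,
          ← sub_eq_add_neg]
      · rw [← hB]
        nlinarith [sq_nonneg (n₀ : ℝ)]
    · rw [hA, Nat.mul_div_cancel_left m hr0]

theorem theorem1p3 (s : ℕ) (hs : 1 < s) :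
    ∃ L : ℝ, 0 < L ∧ ∀ r : ℕ, s < r → ∃ n₀ : ℕ, ∀ ε : ℝ, 0 < ε → ∃ c : ℝ, 0 < c ∧
      ∀ n : ℕ, 0 < n → r ∣ n →
        ∃ (G : SimpleGraph (Fin n)) (_ : DecidableRel G.Adj),
          (G.minDegree : ℝ) = (1 - (s : ℝ) / (r : ℝ)) * (n : ℝ) ∧
          (∃ p : unitInterval, (p : ℝ) = c * PerturbedCliqueFactor.pThreshold s n ∧
            (SimpleGraph.binomialRandom (Fin n) p).real
              {R : SimpleGraph (Fin n) | PerturbedCliqueFactor.HasCliqueFactor r (G ⊔ R)} < ε) ∧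
          (s = 2 → Nonempty (G ≃g SimpleGraph.completeMultipartiteGraph
            (fun i : Fin ((r + 1) / 2) => Fin (PerturbedCliqueFactor.classSize r n i)))) ∧
          (3 ≤ s → n₀ ≤ n → ∃ A : Finset (Fin n),
            A.card = s * (n / r) + ⌈(n : ℝ) ^ (1 - PerturbedCliqueFactor.phi s)⌉₊ ∧
            (∀ u v : Fin n, u ≠ v → ¬ (u ∈ A ∧ v ∈ A) → G.Adj u v) ∧
            PerturbedCliqueFactor.IsPseudorandomBipartite (G.induce (A : Set (Fin n)))
              (s + 1) L ((n : ℝ) ^ (1 - PerturbedCliqueFactor.phi s))) := by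
  rcases Nat.lt_or_ge 2 s with h | h
  · obtain ⟨L, hL, hmain⟩ := exists_graph_of_three_le s h
    refine ⟨L, hL, fun r hr => ?_⟩
    obtain ⟨n₀, hn₀⟩ := hmain r hr
    refine ⟨n₀, fun ε hε => ?_⟩
    obtain ⟨c, hc, hG⟩ := hn₀ ε hε
    refine ⟨c, hc, fun n hn hrn => ?_⟩
    obtain ⟨G, hdec, hdeg, hp, hA⟩ := hG n hn hrn
    exact ⟨G, hdec, hdeg, hp, fun h2 => absurd h2 (by omega), fun _ => hA⟩
  · obtain rfl : s = 2 := by omega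
    -- `L` and `n₀` are arbitrary here, since they enter only the clause for `s ≥ 3`.
    refine ⟨1, one_pos, fun r hr => ⟨0, fun ε hε => ?_⟩⟩
    obtain ⟨c, hc, hG⟩ := exists_graph_of_eq_two r hr ε hε
    refine ⟨c, hc, fun n hn hrn => ?_⟩
    obtain ⟨G, hdec, hdeg, hp, hiso⟩ := hG n hn hrn
    exact ⟨G, hdec, hdeg, hp, fun _ => hiso, fun h3 => absurd h3 (by norm_num)⟩
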